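/- Let $(X,d)$ be a complete metric space with a Borel measure $\mu$ that is doubling, i.e. there is $C_d>1$ with $0<\mu(B(x,2r))\le C_d\,\mu(B(x,r))<\infty$ for all $x\in X$, $r>0$, where $B(x,r)$ is the open ball. Suppose that $X$ satisfies an annular decay property: there are $0\le\alpha\le1$ and $C\ge1$ such that $\mu\big(B(x,r)\setminus B(x,(1-\delta)r)\big)\le C\delta^\alpha\mu(B(x,r))$ for all $x\in X$, $r>0$, $0<\delta<1$. Let $1<p,s<\infty$. For a nonnegative measurable function $f$ and a ball $B$ write $\langle f\rangle_B=\mu(B)^{-1}\int_B f\,d\mu$. For a nonnegative function $w\in L^1_{\mathrm{loc}}(X)$, with $B$ ranging over all open balls (and $0^{-1/(p-1)}=\infty$, $0\cdot\infty=0$), say that - $w\in A_p(X)$ if $\sup_B\big(\langle w\rangle_B\big)\big(\langle w^{-1/(p-1)}\rangle_B\big)^{p-1}<\infty$; - $w\in A_1(X)$ if there is $C<\infty$ with $\langle w\rangle_B\le C\operatorname{ess\,inf}_B w$ for every $B$; - $w\in RH_s(X)$ if there is $C<\infty$ with $\big(\langle w^s\rangle_B\big)^{1/s}\le C\langle w\rangle_B$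 for every $B$; - $w\in RH_\infty(X)$ if there is $C<\infty$ with $\operatorname{ess\,sup}_B w\le C\langle w\rangle_B$ for every $B$. Then $w\in A_p(X)\cap RH_s(X)$ if and only if $w=w_1w_2$ almost everywhere for some $w_1\in A_1(X)\cap RH_s(X)$ and $w_2\in A_p(X)\cap RH_\infty(X)$. -/

import Mathlib

open MeasureTheory Metric Set
open scoped ENNReal NNReal

namespace JonesFactorization

variable {X : Type*} [MetricSpace X] [MeasurableSpace X]

/-- `μ` is doubling: `0 < μ(2B) ≤ C_d μ(B) < ∞` for all open balls `B`, with some `C_d > 1`. -/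
def IsDoubling (μ : Measure X) : Prop :=
  ∃ C : ℝ≥0, 1 < C ∧ ∀ (x : X) (r : ℝ), 0 < r →
    0 < μ (ball x (2 * r)) ∧ μ (ball x (2 * r)) ≤ C * μ (ball x r) ∧ C * μ (ball x r) < ∞

/-- The `α`-annular decay property. -/
def HasAnnularDecayWith (μ : Measure X) (α : ℝ) : Prop :=
  ∃ C : ℝ, 1 ≤ C ∧ ∀ (x : X) (r δ : ℝ), 0 < r → 0 < δ → δ < 1 →
    μ (ball x r \ ball x ((1 - δ) * r)) ≤ ENNReal.ofReal (C * δ ^ α) * μ (ball x r)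

/-- An annular decay property: the `α`-annular decay property for some `0 ≤ α ≤ 1`. -/
def HasAnnularDecay (μ : Measure X) : Prop :=
  ∃ α : ℝ, 0 ≤ α ∧ α ≤ 1 ∧ HasAnnularDecayWith μ α

/-- A weight: a nonnegative locally integrable function. -/
def IsWeight (μ : Measure X) (w : X → ℝ) : Prop :=
  0 ≤ᵐ[μ] w ∧ LocallyIntegrable w μ

/-- The Muckenhoupt constant `[w]_{A_p}`, for `1 < p < ∞`. Powers and averages are taken in
`[0, ∞]`, so that `w ^ (-1 / (p - 1))` is `∞` where `w` vanishes. -/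
noncomputable def muckenhouptConst (μ : Measure X) (p : ℝ) (w : X → ℝ) : ℝ≥0∞ :=
  ⨆ (x : X) (r : ℝ) (_ : 0 < r),
    (⨍⁻ y in ball x r, ENNReal.ofReal (w y) ∂μ) *
      (⨍⁻ y in ball x r, ENNReal.ofReal (w y) ^ (-(1 / (p - 1))) ∂μ) ^ (p - 1)

/-- The Muckenhoupt class `A_p`, for `1 < p < ∞`. -/
def MuckenhouptA (μ : Measure X) (p : ℝ) (w : X → ℝ) : Prop :=
  IsWeight μ w ∧ muckenhouptConst μ p w < ∞

/-- The Muckenhoupt class `A_1`. -/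
def MuckenhouptAOne (μ : Measure X) (w : X → ℝ) : Prop :=
  IsWeight μ w ∧ ∃ C : ℝ≥0, ∀ (x : X) (r : ℝ), 0 < r →
    ⨍⁻ y in ball x r, ENNReal.ofReal (w y) ∂μ ≤
      C * essInf (fun y => ENNReal.ofReal (w y)) (μ.restrict (ball x r))

/-- The reverse Hölder class `RH_s`, for `1 < s < ∞`. -/
def ReverseHolder (μ : Measure X) (s : ℝ) (w : X → ℝ) : Prop :=
  IsWeight μ w ∧ ∃ C : ℝ≥0, ∀ (x : X) (r : ℝ), 0 < r →
    (⨍⁻ y in ball x r, ENNReal.ofReal (w y) ^ s ∂μ) ^ (1 / s) ≤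
      C * ⨍⁻ y in ball x r, ENNReal.ofReal (w y) ∂μ

/-- The reverse Hölder class `RH_∞`. -/
def ReverseHolderTop (μ : Measure X) (w : X → ℝ) : Prop :=
  IsWeight μ w ∧ ∃ C : ℝ≥0, ∀ (x : X) (r : ℝ), 0 < r →
    essSup (fun y => ENNReal.ofReal (w y)) (μ.restrict (ball x r)) ≤
      C * ⨍⁻ y in ball x r, ENNReal.ofReal (w y) ∂μ

end JonesFactorization

namespace JonesFactorization

variable {X : Type*} [MetricSpace X] [MeasurableSpace X]

/-! ### Doubling measures -/

/-! The case $w = 0$ a.e. is trivial, and an $A_p$ weight is otherwise positive a.e. For positive $w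
\in A_p \cap RH_s$ put $q = s(p-1)+1$. Then $(w^s)^{-1/(q-1)} = w^{-1/(p-1)}$, so the two hypotheses
together say that $w^s \in A_q$ (`isPosMuckenhoupt_rpow`). Jones' theorem
(`IsPosMuckenhoupt.exists_factorization`) gives $w^s = v_1 v_2^{1-q}$ with $v_1, v_2 \in A_1$, and
taking $s$-th roots gives $w = v_1^{1/s} v_2^{1-p}$. Since $v_i$ is at least a multiple of its
average on each ball, Jensen and Hölder place the two factors in $A_1 \cap RH_s$ and $A_p \cap
RH_\infty$ (`IsPosMuckenhouptOne.rpow_one_div`, `IsPosMuckenhouptOne.rpow_one_sub`).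

Jones' theorem comes from the Rubio de Francia algorithm: a sublinear operator $T$ bounded on $L^q$
has a function $\eta \in L^q$ with $T\eta \le C\eta$. With $T$ the sum of two weighted maximal
operators, this one inequality contains both $A_1$ conditions. Boundedness of $T$ is Muckenhoupt's
theorem for $W$ and its dual weight $\sigma$. That theorem is proved without self-improvement of
$A_p$, by Lerner's pointwise bound of $M$ through $M_W$ and $M_\sigma$
(`IsPosMuckenhoupt.exists_maximal_rpow_le`). As $W\,d\mu$ and $\sigma\,d\mu$ are again doubling, the
maximal theorem for doubling measures applies to each.

Conversely, on a ball $B$ the weight $w_1$ has average comparable to $\operatorname{ess\,inf}_B w_1$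
and $w_2$ is at most a multiple of its average. So $\langle w_1 w_2\rangle_B$ is comparable to
$\operatorname{ess\,inf}_B w_1\,\langle w_2\rangle_B$, and both conditions for the product follow.
-/

lemma IsDoubling.measure_ball_pos {μ : Measure X} (hμ : IsDoubling μ) (x : X) {r : ℝ}
    (hr : 0 < r) : 0 < μ (ball x r) := by
  obtain ⟨C, -, h⟩ := hμ
  simpa [mul_div_cancel₀] using (h x (r / 2) (by positivity)).1

lemma IsDoubling.measure_ball_lt_top {μ : Measure X} (hμ : IsDoubling μ) (x : X) (r : ℝ) :
    μ (ball x r) < ∞ := by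
  obtain ⟨C, hC, h⟩ := hμ
  rcases le_or_gt r 0 with hr | hr
  · simp [ball_eq_empty.2 hr]
  · have h3 := (h x r hr).2.2
    rcases ENNReal.mul_lt_top_iff.1 h3 with h4 | h4 | h4
    · exact h4.2
    · simp only [ENNReal.coe_eq_zero] at h4
      simp [h4] at hC
    · simp [h4]

lemma IsDoubling.sigmaFinite [BorelSpace X] {μ : Measure X} (hμ : IsDoubling μ) :
    SigmaFinite μ := by
  rcases isEmpty_or_nonempty X with h | ⟨⟨x⟩⟩
  · rw [Measure.eq_zero_of_isEmpty μ]; infer_instance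
  · exact ⟨⟨⟨fun n => ball x n, fun _ => trivial, fun n => hμ.measure_ball_lt_top x n,
      iUnion_ball_nat x⟩⟩⟩

/-- Disjoint sets of positive measure are countably many in a σ-finite space. This makes the
disjoint families from Vitali's covering lemma countable. -/
lemma IsDoubling.countable_of_pairwiseDisjoint [BorelSpace X] {μ : Measure X}
    (hμ : IsDoubling μ) {ι : Type*} {u : Set ι} {x : ι → X} {r : ι → ℝ}
    (hr : ∀ a ∈ u, 0 < r a) (hu : u.PairwiseDisjoint fun a => closedBall (x a) (r a)) :
    u.Countable := by
  have := hμ.sigmaFinite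
  have h := Measure.countable_meas_pos_of_disjoint_iUnion (μ := μ)
    (As := fun a : u => ball (x a) (r a)) (fun a => measurableSet_ball) (fun a b hab => by
      have := hu a.2 b.2 (fun h => hab (Subtype.ext h))
      exact this.mono ball_subset_closedBall ball_subset_closedBall)
  have h2 : {a : u | 0 < μ (ball (x a) (r a))} = univ :=
    eq_univ_of_forall fun a => hμ.measure_ball_pos _ (hr a a.2)
  rw [h2, countable_univ_iff] at h
  exact h

/-- Centres of a maximal-type disjoint family of balls of radius `ε / 4` form a countable `ε`-dense
set. Needed to pass from local integrability to a.e. measurability of weights. -/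
lemma IsDoubling.secondCountableTopology [BorelSpace X] {μ : Measure X} (hμ : IsDoubling μ) :
    SecondCountableTopology X := by
  refine Metric.secondCountable_of_almost_dense_set fun ε hε => ?_
  obtain ⟨u, -, hu, hcov⟩ := Vitali.exists_disjoint_subfamily_covering_enlargement_closedBall
    (univ : Set X) id (fun _ => ε / 4) (ε / 4) (fun _ _ => le_rfl) 4 (by norm_num)
  refine ⟨u, hμ.countable_of_pairwiseDisjoint (fun _ _ => by positivity) hu, fun x => ?_⟩
  obtain ⟨b, hb, hxb⟩ := hcov x (mem_univ x)
  refine ⟨b, hb, ?_⟩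
  have := hxb (mem_closedBall_self (by positivity))
  simpa [mem_closedBall, mul_div_cancel₀] using this

lemma IsDoubling.exists_measure_enlarge_le {μ : Measure X} (hμ : IsDoubling μ) :
    ∃ D : ℝ≥0, ∀ (x : X) (r : ℝ), 0 < r → μ (closedBall x (4 * r)) ≤ D * μ (ball x r) := by
  obtain ⟨C, -, h⟩ := hμ
  refine ⟨C * (C * C), fun x r hr => ?_⟩
  calc μ (closedBall x (4 * r)) ≤ μ (ball x (2 * (2 * (2 * r)))) :=
        measure_mono (closedBall_subset_ball (by linarith))
    _ ≤ C * (C * (C * μ (ball x r))) := by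
        refine (h x _ (by positivity)).2.1.trans ?_
        gcongr
        refine (h x _ (by positivity)).2.1.trans ?_
        gcongr
        exact (h x _ hr).2.1
    _ = _ := by push_cast; ring

/-! ### The uncentred maximal function -/

/-- The uncentred Hardy–Littlewood maximal function with respect to `μ`. -/
noncomputable def maximal (μ : Measure X) (g : X → ℝ≥0∞) (x : X) : ℝ≥0∞ :=
  ⨆ (z : X) (r : ℝ) (_ : 0 < r) (_ : x ∈ ball z r), ⨍⁻ y in ball z r, g y ∂μ

lemma laverage_le_maximal (μ : Measure X) (g : X → ℝ≥0∞) {x z : X} {r : ℝ} (hx : x ∈ ball z r) :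
    ⨍⁻ y in ball z r, g y ∂μ ≤ maximal μ g x := by
  have hr : 0 < r := pos_of_mem_ball hx
  exact le_iSup_of_le z (le_iSup_of_le r (le_iSup_of_le hr (le_iSup_of_le hx le_rfl)))

lemma maximal_le {μ : Measure X} {g : X → ℝ≥0∞} {x : X} {c : ℝ≥0∞}
    (h : ∀ z r, x ∈ ball z r → ⨍⁻ y in ball z r, g y ∂μ ≤ c) : maximal μ g x ≤ c :=
  iSup_le fun z => iSup_le fun r => iSup_le fun _ => iSup_le fun hx => h z r hx

lemma lt_maximal_iff {μ : Measure X} {g : X → ℝ≥0∞} {x : X} {c : ℝ≥0∞} :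
    c < maximal μ g x ↔ ∃ z r, x ∈ ball z r ∧ c < ⨍⁻ y in ball z r, g y ∂μ := by
  constructor
  · intro h
    by_contra! h'
    exact absurd h (not_lt.2 (maximal_le h'))
  · rintro ⟨z, r, hx, h⟩
    exact h.trans_le (laverage_le_maximal μ g hx)

lemma measurable_maximal [BorelSpace X] (μ : Measure X) (g : X → ℝ≥0∞) :
    Measurable (maximal μ g) := by
  -- For the uncentred maximal function a ball witnessing `c < maximal μ g x` serves all its points,
  -- so superlevel sets are open whatever `g` is.
  refine measurable_of_Ioi fun c => IsOpen.measurableSet ?_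
  rw [Metric.isOpen_iff]
  intro x hx
  obtain ⟨z, r, hxz, h⟩ := lt_maximal_iff.1 hx
  obtain ⟨ε, hε, hsub⟩ := Metric.isOpen_iff.1 (isOpen_ball (x := z) (ε := r)) x hxz
  exact ⟨ε, hε, fun y hy => lt_maximal_iff.2 ⟨z, r, hsub hy, h⟩⟩

lemma measure_le_of_lt_laverage {Y : Type*} [MeasurableSpace Y] {μ : Measure Y}
    {g : Y → ℝ≥0∞} {s : Set Y} {c : ℝ≥0∞}
    (h : c < ⨍⁻ y in s, g y ∂μ) : c * μ s ≤ ∫⁻ y in s, g y ∂μ := by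
  rw [setLAverage_eq] at h
  exact ENNReal.mul_le_of_le_div h.le

/-- The weak type `(1, 1)` inequality for balls of bounded radius. -/
lemma IsDoubling.weak_type_bounded_radius [BorelSpace X] {μ : Measure X} (hμ : IsDoubling μ)
    {D : ℝ≥0} (hD : ∀ (x : X) (r : ℝ), 0 < r → μ (closedBall x (4 * r)) ≤ D * μ (ball x r))
    (g : X → ℝ≥0∞) (c : ℝ≥0∞) (R : ℝ) :
    c * μ {x | ∃ z r, x ∈ ball z r ∧ r ≤ R ∧ c < ⨍⁻ y in ball z r, g y ∂μ} ≤
      D * ∫⁻ y, g y ∂μ := by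
  obtain ⟨u, hut, hu, hcov⟩ := Vitali.exists_disjoint_subfamily_covering_enlargement_closedBall
    {a : X × ℝ | 0 < a.2 ∧ a.2 ≤ R ∧ c < ⨍⁻ y in ball a.1 a.2, g y ∂μ} Prod.fst Prod.snd R
    (fun a ha => ha.2.1) 4 (by norm_num)
  have hc : u.Countable := hμ.countable_of_pairwiseDisjoint (fun a ha => (hut ha).1) hu
  have hsub : {x | ∃ z r, x ∈ ball z r ∧ r ≤ R ∧ c < ⨍⁻ y in ball z r, g y ∂μ} ⊆
      ⋃ b ∈ u, closedBall b.1 (4 * b.2) := by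
    rintro x ⟨z, r, hx, hr, h⟩
    obtain ⟨b, hb, hsb⟩ := hcov (z, r) ⟨pos_of_mem_ball hx, hr, h⟩
    exact mem_biUnion hb (hsb (ball_subset_closedBall hx))
  have := hc.to_subtype
  calc _ ≤ c * ∑' b : u, μ (closedBall b.1.1 (4 * b.1.2)) := by
        gcongr
        exact (measure_mono hsub).trans (measure_biUnion_le μ hc _)
    _ ≤ ∑' b : u, D * ∫⁻ y in ball b.1.1 b.1.2, g y ∂μ := by
        rw [← ENNReal.tsum_mul_left]
        refine ENNReal.tsum_le_tsum fun b => ?_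
        calc _ ≤ c * (D * μ (ball b.1.1 b.1.2)) := by
              gcongr
              exact hD _ _ (hut b.2).1
          _ = D * (c * μ (ball b.1.1 b.1.2)) := by ring
          _ ≤ _ := by
              gcongr
              exact measure_le_of_lt_laverage (hut b.2).2.2
    _ = D * ∫⁻ y in ⋃ b : u, ball b.1.1 b.1.2, g y ∂μ := by
        rw [ENNReal.tsum_mul_left, lintegral_iUnion (fun _ => measurableSet_ball)]
        intro a b hab
        exact (hu a.2 b.2 (fun h => hab (Subtype.ext h))).mono
          ball_subset_closedBall ball_subset_closedBall
    _ ≤ _ := by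
        gcongr
        exact Measure.restrict_le_self

/-- The weak type `(1, 1)` inequality. -/
lemma IsDoubling.exists_weak_type [BorelSpace X] {μ : Measure X} (hμ : IsDoubling μ) :
    ∃ D : ℝ≥0, ∀ (g : X → ℝ≥0∞) (c : ℝ≥0∞),
      c * μ {x | c < maximal μ g x} ≤ D * ∫⁻ y, g y ∂μ := by
  obtain ⟨D, hD⟩ := hμ.exists_measure_enlarge_le
  refine ⟨D, fun g c => ?_⟩
  have heq : {x | c < maximal μ g x} =
      ⋃ n : ℕ, {x | ∃ z r, x ∈ ball z r ∧ r ≤ n ∧ c < ⨍⁻ y in ball z r, g y ∂μ} := by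
    ext x
    simp only [mem_ofPred_eq, mem_iUnion, lt_maximal_iff]
    constructor
    · rintro ⟨z, r, hx, h⟩
      obtain ⟨n, hn⟩ := exists_nat_ge r
      exact ⟨n, z, r, hx, hn, h⟩
    · rintro ⟨n, z, r, hx, -, h⟩
      exact ⟨z, r, hx, h⟩
  -- Vitali's lemma needs bounded radii; continuity of the measure along this increasing union
  -- removes the bound.
  have hmono : Monotone fun n : ℕ =>
      {x | ∃ z r, x ∈ ball z r ∧ r ≤ n ∧ c < ⨍⁻ y in ball z r, g y ∂μ} := by
    rintro m n hmn x ⟨z, r, hx, hr, h⟩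
    exact ⟨z, r, hx, hr.trans (by exact_mod_cast hmn), h⟩
  rw [heq, hmono.measure_iUnion, ENNReal.mul_iSup]
  exact iSup_le fun n => hμ.weak_type_bounded_radius hD g c n

/-- Truncation: `g` is at most its part above `c` plus the constant `c`, whose averages are `c`. It
lets the weak type inequality at height `t` see only the part of `g` above `t / 2`. -/
lemma IsDoubling.maximal_le_of_split [BorelSpace X] {μ : Measure X} (hμ : IsDoubling μ)
    (g : X → ℝ≥0∞) (c : ℝ≥0∞) (x : X) :
    maximal μ g x ≤ maximal μ ({y | c < g y}.indicator g) x + c := by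
  refine maximal_le fun z r hx => ?_
  have hr := pos_of_mem_ball hx
  calc ⨍⁻ y in ball z r, g y ∂μ
      ≤ ⨍⁻ y in ball z r, ({y | c < g y}.indicator g y + c) ∂μ := by
        refine setLAverage_mono_ae _ (.of_forall fun y => ?_)
        by_cases h : c < g y
        · simp [h]
        · simpa [h] using not_lt.1 h
    _ = ⨍⁻ y in ball z r, {y | c < g y}.indicator g y ∂μ + ⨍⁻ y in ball z r, c ∂μ := by
        rw [laverage_eq, laverage_eq, laverage_eq, ← ENNReal.add_div,
          lintegral_add_right _ measurable_const]
    _ ≤ _ := by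
        rw [setLAverage_const (hμ.measure_ball_pos z hr).ne' (hμ.measure_ball_lt_top z r).ne]
        gcongr
        exact laverage_le_maximal μ _ hx

/-- The layer cake representation of a power. -/
lemma lintegral_layer {a : ℝ} (ha : 0 < a) (x : ℝ≥0∞) :
    ∫⁻ t in Ioi (0 : ℝ), {t : ℝ | ENNReal.ofReal t < x}.indicator
      (fun t => ENNReal.ofReal (a * t ^ (a - 1))) t = x ^ a := by
  have hfin : ∀ b : ℝ, 0 ≤ b → ∫⁻ t in Ioi (0 : ℝ), {t : ℝ | ENNReal.ofReal t <
      ENNReal.ofReal b}.indicator (fun t => ENNReal.ofReal (a * t ^ (a - 1))) t =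
      ENNReal.ofReal b ^ a := by
    intro b hb
    have hset : {t : ℝ | ENNReal.ofReal t < ENNReal.ofReal b} ∩ Ioi 0 = Ioo 0 b := by
      ext t
      simp only [mem_inter_iff, mem_ofPred_eq, mem_Ioi, mem_Ioo]
      constructor
      · rintro ⟨h1, h2⟩
        exact ⟨h2, (ENNReal.ofReal_lt_ofReal_iff_of_nonneg h2.le).1 h1⟩
      · rintro ⟨h1, h2⟩
        exact ⟨(ENNReal.ofReal_lt_ofReal_iff_of_nonneg h1.le).2 h2, h1⟩
    rw [lintegral_indicator (measurableSet_lt ENNReal.measurable_ofReal measurable_const),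
      Measure.restrict_restrict (measurableSet_lt ENNReal.measurable_ofReal measurable_const),
      hset, restrict_Ioo_eq_restrict_Ioc, ← ofReal_integral_eq_lintegral_ofReal,
      ← intervalIntegral.integral_of_le hb, intervalIntegral.integral_const_mul,
      integral_rpow (Or.inl (by linarith)), ENNReal.ofReal_rpow_of_nonneg hb ha.le]
    · congr 1
      rw [sub_add_cancel, Real.zero_rpow ha.ne']
      field_simp
      ring
    · have := (intervalIntegral.intervalIntegrable_rpow' (a := 0) (b := b)
        (r := a - 1) (by linarith)).const_mul a
      exact (intervalIntegrable_iff_integrableOn_Ioc_of_le hb).1 this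
    · filter_upwards [ae_restrict_mem measurableSet_Ioc] with t ht
      have := ht.1
      positivity
  -- At `x = ∞` the integral dominates the finite case at `c ^ a⁻¹`, which equals `c`, for every
  -- `c`.
  rcases eq_or_ne x ∞ with rfl | hx
  · rw [ENNReal.top_rpow_of_pos ha]
    refine ENNReal.eq_top_of_forall_nnreal_le fun c => ?_
    have h1 := hfin ((c : ℝ) ^ a⁻¹) (by positivity)
    rw [ENNReal.ofReal_rpow_of_nonneg (by positivity) ha.le, ← Real.rpow_mul (NNReal.coe_nonneg c),
      inv_mul_cancel₀ ha.ne', Real.rpow_one, ENNReal.ofReal_coe_nnreal] at h1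
    rw [← h1]
    refine lintegral_mono fun t => ?_
    exact indicator_le_indicator_of_subset (fun t _ => ENNReal.ofReal_lt_top) (fun _ => zero_le) t
  · simpa [ENNReal.ofReal_toReal hx] using hfin x.toReal ENNReal.toReal_nonneg

lemma lintegral_rpow_eq_lintegral_measure_lt {Y : Type*} [MeasurableSpace Y] {ν : Measure Y}
    [SFinite ν] {a : ℝ} (ha : 0 < a) {F : Y → ℝ≥0∞} (hF : Measurable F) {G : Y → ℝ≥0∞}
    (hG : Measurable G) :
    ∫⁻ y, G y * F y ^ a ∂ν = ∫⁻ t in Ioi (0 : ℝ), ENNReal.ofReal (a * t ^ (a - 1)) *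
      ∫⁻ y in {y | ENNReal.ofReal t < F y}, G y ∂ν := by
  have hm : MeasurableSet {z : Y × ℝ | ENNReal.ofReal z.2 < F z.1} :=
    measurableSet_lt (ENNReal.measurable_ofReal.comp measurable_snd) (hF.comp measurable_fst)
  have hφ : Measurable fun t : ℝ => ENNReal.ofReal (a * t ^ (a - 1)) := by fun_prop
  calc ∫⁻ y, G y * F y ^ a ∂ν
      = ∫⁻ y, (∫⁻ t in Ioi (0 : ℝ), {z : Y × ℝ | ENNReal.ofReal z.2 < F z.1}.indicator
          (fun z => ENNReal.ofReal (a * z.2 ^ (a - 1)) * G z.1) (y, t)) ∂ν := by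
        refine lintegral_congr fun y => ?_
        rw [← lintegral_layer ha, ← lintegral_const_mul _ (hφ.indicator
          (measurableSet_lt ENNReal.measurable_ofReal measurable_const))]
        refine lintegral_congr fun t => ?_
        by_cases h : ENNReal.ofReal t < F y
        · simp [indicator, h, mul_comm]
        · simp [indicator, h]
    _ = _ := by
        rw [lintegral_lintegral_swap]
        · refine lintegral_congr fun t => ?_
          rw [← lintegral_indicator (measurableSet_lt measurable_const hF),
            ← lintegral_const_mul _ (hG.indicator (measurableSet_lt measurable_const hF))]
          refine lintegral_congr fun y => ?_
          by_cases h : ENNReal.ofReal t < F y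
          · simp [indicator, h]
          · simp [indicator, h]
        · refine Measurable.aemeasurable ?_
          exact Measurable.indicator ((hφ.comp measurable_snd).mul (hG.comp measurable_fst)) hm

/-- The Hardy–Littlewood maximal theorem for doubling measures. -/
theorem IsDoubling.exists_lintegral_maximal_rpow_le [BorelSpace X] {μ : Measure X}
    (hμ : IsDoubling μ) {q : ℝ} (hq : 1 < q) :
    ∃ K : ℝ≥0, ∀ g : X → ℝ≥0∞, Measurable g →
      ∫⁻ x, maximal μ g x ^ q ∂μ ≤ K * ∫⁻ x, g x ^ q ∂μ := by
  have := hμ.sigmaFinite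
  obtain ⟨D, hD⟩ := hμ.exists_weak_type
  refine ⟨(q / (q - 1)).toNNReal * (2 * D) * 2 ^ (q - 1), fun g hg => ?_⟩
  have hq1 : 0 < q - 1 := by linarith
  have hweak : ∀ t : ℝ, 0 < t → ENNReal.ofReal t * μ {x | ENNReal.ofReal t < maximal μ g x} ≤
      2 * D * ∫⁻ y in {y | ENNReal.ofReal t < 2 * g y}, g y ∂μ := by
    intro t ht
    have hsub : {x | ENNReal.ofReal t < maximal μ g x} ⊆
        {x | ENNReal.ofReal t / 2 < maximal μ ({y | ENNReal.ofReal t / 2 < g y}.indicator g) x} := by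
      intro x hx
      have h1 := lt_of_lt_of_le hx (hμ.maximal_le_of_split g (ENNReal.ofReal t / 2) x)
      simp only [mem_ofPred_eq]
      by_contra! h2
      refine absurd h1 (not_lt.2 ((add_le_add_left h2 _).trans ?_))
      rw [ENNReal.add_halves]
    have hset : {y | ENNReal.ofReal t / 2 < g y} = {y | ENNReal.ofReal t < 2 * g y} := by
      ext y
      simp only [mem_ofPred_eq]
      rw [ENNReal.div_lt_iff (by simp) (by simp), mul_comm]
    have h2 := hD ({y | ENNReal.ofReal t / 2 < g y}.indicator g) (ENNReal.ofReal t / 2)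
    rw [lintegral_indicator (measurableSet_lt measurable_const hg), hset] at h2
    calc _ = 2 * (ENNReal.ofReal t / 2 * μ {x | ENNReal.ofReal t < maximal μ g x}) := by
          rw [← mul_assoc, ENNReal.mul_div_cancel (by simp) (by simp)]
      _ ≤ 2 * (D * ∫⁻ y in {y | ENNReal.ofReal t < 2 * g y}, g y ∂μ) := by
          refine mul_le_mul_right (le_trans ?_ h2) 2
          rw [← hset]
          gcongr
      _ = _ := by ring
  -- Layer cake is used twice: with exponent `q` to unfold the left side, and with exponent `q - 1`,
  -- `F = 2 * g` and density `g` to reassemble the integrated weak type bound.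
  have hlayer := lintegral_rpow_eq_lintegral_measure_lt (ν := μ) (a := q) (by linarith)
    (measurable_maximal μ g) (G := fun _ => 1) measurable_const
  have hlayer2 := lintegral_rpow_eq_lintegral_measure_lt (ν := μ) (a := q - 1) (by linarith)
    (F := fun y => 2 * g y) (hg.const_mul 2) hg
  simp only [one_mul, lintegral_const, MeasurableSet.univ, Measure.restrict_apply, univ_inter]
    at hlayer
  have hc : ((q / (q - 1)).toNNReal : ℝ≥0∞) = ENNReal.ofReal (q / (q - 1)) := rfl
  calc ∫⁻ x, maximal μ g x ^ q ∂μ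
      = ∫⁻ t in Ioi (0 : ℝ), ENNReal.ofReal (q * t ^ (q - 1)) *
          μ {x | ENNReal.ofReal t < maximal μ g x} := hlayer
    _ ≤ ∫⁻ t in Ioi (0 : ℝ), (ENNReal.ofReal (q / (q - 1)) * (2 * D)) *
          (ENNReal.ofReal ((q - 1) * t ^ (q - 1 - 1)) *
          ∫⁻ y in {y | ENNReal.ofReal t < 2 * g y}, g y ∂μ) := by
        refine setLIntegral_mono' measurableSet_Ioi fun t (ht : 0 < t) => ?_
        have h3 : ENNReal.ofReal (q * t ^ (q - 1)) = ENNReal.ofReal (q / (q - 1)) *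
            ENNReal.ofReal ((q - 1) * t ^ (q - 1 - 1)) * ENNReal.ofReal t := by
          rw [← ENNReal.ofReal_mul (by positivity), ← ENNReal.ofReal_mul (by positivity)]
          congr 1
          rw [Real.rpow_sub_one ht.ne' (q - 1)]
          field_simp
        rw [h3, mul_assoc]
        refine (mul_le_mul_right (hweak t ht) _).trans (le_of_eq ?_)
        ring
    _ = (ENNReal.ofReal (q / (q - 1)) * (2 * D)) * ∫⁻ y, g y * (2 * g y) ^ (q - 1) ∂μ := by
        rw [lintegral_const_mul' _ _ (by finiteness), hlayer2]
    _ = _ := by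
        have h4 : ∀ y, g y * (2 * g y) ^ (q - 1) = 2 ^ (q - 1) * g y ^ q := by
          intro y
          rw [ENNReal.mul_rpow_of_nonneg _ _ hq1.le, ← mul_assoc, mul_comm (g y), mul_assoc]
          congr 1
          nth_rewrite 1 [← ENNReal.rpow_one (g y)]
          rw [← ENNReal.rpow_add_of_nonneg _ _ zero_le_one hq1.le]
          congr 1
          ring
        simp_rw [h4]
        rw [lintegral_const_mul _ (hg.pow_const q), ← mul_assoc]
        congr 1
        rw [ENNReal.coe_mul, ENNReal.coe_mul, hc, ENNReal.coe_rpow_of_nonneg _ hq1.le]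
        simp

/-! ### Muckenhoupt weights with values in `(0, ∞)` -/

/-- Hölder's inequality in the form `1 ≤ ⟨W⟩ ⟨W ^ (-1 / (p - 1))⟩ ^ (p - 1)`. -/
lemma measure_univ_rpow_le_lintegral_mul {Y : Type*} [MeasurableSpace Y] {ν : Measure Y} {p : ℝ}
    (hp : 1 < p) {W : Y → ℝ≥0∞} (hW : AEMeasurable W ν) (h0 : ∀ᵐ y ∂ν, W y ≠ 0)
    (htop : ∀ᵐ y ∂ν, W y ≠ ∞) :
    ν univ ^ p ≤ (∫⁻ y, W y ∂ν) * (∫⁻ y, W y ^ (-(1 / (p - 1))) ∂ν) ^ (p - 1) := by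
  have hp0 : 0 < p := by linarith
  have hp1 : 0 < p - 1 := by linarith
  have hpq : p.HolderConjugate (p / (p - 1)) := Real.HolderConjugate.conjExponent hp
  -- Hölder for the splitting `1 = W ^ (1 / p) * W ^ (-(1 / p))`.
  have h := ENNReal.lintegral_mul_le_Lp_mul_Lq ν hpq (hW.pow_const (1 / p))
    (hW.pow_const (-(1 / p)))
  have h1 : ∫⁻ y, ((fun y => W y ^ (1 / p)) * fun y => W y ^ (-(1 / p))) y ∂ν = ν univ := by
    rw [← setLIntegral_one, Measure.restrict_univ]
    refine lintegral_congr_ae ?_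
    filter_upwards [h0, htop] with y hy hy'
    rw [Pi.mul_apply, ← ENNReal.rpow_add _ _ hy hy']
    simp
  have h2 : ∀ y, (W y ^ (1 / p)) ^ p = W y := fun y => by
    rw [← ENNReal.rpow_mul, one_div_mul_cancel hp0.ne', ENNReal.rpow_one]
  have h3 : ∀ y, (W y ^ (-(1 / p))) ^ (p / (p - 1)) = W y ^ (-(1 / (p - 1))) := fun y => by
    rw [← ENNReal.rpow_mul]
    congr 1
    field_simp
  rw [h1] at h
  simp only [h2, h3] at h
  calc ν univ ^ p ≤ _ := ENNReal.rpow_le_rpow h hp0.le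
    _ = _ := by
      rw [ENNReal.mul_rpow_of_nonneg _ _ hp0.le, ← ENNReal.rpow_mul, ← ENNReal.rpow_mul,
        one_div_mul_cancel hp0.ne', ENNReal.rpow_one]
      congr 2
      field_simp

/-- A measurable `(0, ∞)`-valued Muckenhoupt weight of class `A_p`. -/
structure IsPosMuckenhoupt (μ : Measure X) (p : ℝ) (W : X → ℝ≥0∞) : Prop where
  measurable : Measurable W
  ne_zero : ∀ x, W x ≠ 0
  ne_top : ∀ x, W x ≠ ∞
  bound : ∃ C : ℝ≥0, ∀ (x : X) (r : ℝ), 0 < r →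
    (⨍⁻ y in ball x r, W y ∂μ) * (⨍⁻ y in ball x r, W y ^ (-(1 / (p - 1))) ∂μ) ^ (p - 1) ≤ C

namespace IsPosMuckenhoupt

variable {μ : Measure X} {p : ℝ} {W : X → ℝ≥0∞}

/-- The dual weight `W ^ (-1 / (p - 1))` is of class `A_{p'}`. -/
lemma dual (hW : IsPosMuckenhoupt μ p W) (hp : 1 < p) :
    IsPosMuckenhoupt μ (p / (p - 1)) fun x => W x ^ (-(1 / (p - 1))) := by
  have hp1 : 0 < p - 1 := by linarith
  have he : p / (p - 1) - 1 = 1 / (p - 1) := by field_simp; ring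
  obtain ⟨C, hC⟩ := hW.bound
  refine ⟨hW.measurable.pow_const _, fun x => ?_, fun x => ?_, C ^ (1 / (p - 1)),
    fun x r hr => ?_⟩
  · simp [ENNReal.rpow_eq_zero_iff, hW.ne_zero x, hW.ne_top x]
  · simp [ENNReal.rpow_eq_top_iff, hW.ne_zero x, hW.ne_top x]
  · have h2 : ∀ y, (W y ^ (-(1 / (p - 1)))) ^ (-(1 / (p / (p - 1) - 1))) = W y := fun y => by
      rw [he, ← ENNReal.rpow_mul, show -(1 / (p - 1)) * -(1 / (1 / (p - 1))) = 1 by field_simp,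
        ENNReal.rpow_one]
    simp only [h2]
    have := ENNReal.rpow_le_rpow (hC x r hr) (one_div_nonneg.2 hp1.le)
    rw [ENNReal.mul_rpow_of_nonneg _ _ (one_div_nonneg.2 hp1.le), ← ENNReal.rpow_mul,
      mul_one_div_cancel hp1.ne', ENNReal.rpow_one] at this
    rw [he, ENNReal.coe_rpow_of_nonneg _ (one_div_nonneg.2 hp1.le), mul_comm]
    exact this

lemma lintegral_ball_pos (hW : IsPosMuckenhoupt μ p W) (hμ : IsDoubling μ) (x : X) {r : ℝ}
    (hr : 0 < r) : 0 < ∫⁻ y in ball x r, W y ∂μ := by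
  rw [setLIntegral_pos_iff hW.measurable, eq_univ_of_forall (s := Function.support W) hW.ne_zero,
    univ_inter]
  exact hμ.measure_ball_pos x hr

lemma exists_lintegral_mul_le (hW : IsPosMuckenhoupt μ p W) (hp : 1 < p) (hμ : IsDoubling μ) :
    ∃ C : ℝ≥0, ∀ (x : X) (r : ℝ), 0 < r →
    (∫⁻ y in ball x r, W y ∂μ) * (∫⁻ y in ball x r, W y ^ (-(1 / (p - 1))) ∂μ) ^ (p - 1) ≤
      C * μ (ball x r) ^ p := by
  have hp1 : 0 < p - 1 := by linarith
  obtain ⟨C, hC⟩ := hW.bound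
  refine ⟨C, fun x r hr => ?_⟩
  have h := hC x r hr
  have hm0 := (hμ.measure_ball_pos x hr).ne'
  have hmt := (hμ.measure_ball_lt_top x r).ne
  rw [← measure_mul_setLAverage _ hmt, ← measure_mul_setLAverage _ hmt,
    ENNReal.mul_rpow_of_nonneg _ _ hp1.le]
  calc _ = μ (ball x r) * μ (ball x r) ^ (p - 1) * ((⨍⁻ y in ball x r, W y ∂μ) *
        (⨍⁻ y in ball x r, W y ^ (-(1 / (p - 1))) ∂μ) ^ (p - 1)) := by ring
    _ ≤ μ (ball x r) * μ (ball x r) ^ (p - 1) * C := mul_le_mul_right h _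
    _ = _ := by
      rw [mul_comm]
      congr 1
      nth_rewrite 1 [← ENNReal.rpow_one (μ (ball x r))]
      rw [← ENNReal.rpow_add _ _ hm0 hmt]
      congr 1
      ring

/-- The dual factor is nonzero, so an infinite integral of `W` would make the `A_p` product
infinite. -/
lemma lintegral_ball_lt_top (hW : IsPosMuckenhoupt μ p W) (hp : 1 < p) (hμ : IsDoubling μ)
    (x : X) (r : ℝ) : ∫⁻ y in ball x r, W y ∂μ < ∞ := by
  rcases le_or_gt r 0 with hr | hr
  · simp [ball_eq_empty.2 hr]
  obtain ⟨C, hC⟩ := hW.exists_lintegral_mul_le hp hμ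
  by_contra! h
  have h1 := hC x r hr
  have h2 : (∫⁻ y in ball x r, W y ^ (-(1 / (p - 1))) ∂μ) ^ (p - 1) ≠ 0 := by
    simp only [ne_eq, ENNReal.rpow_eq_zero_iff, not_or, not_and]
    exact ⟨fun h => absurd h ((hW.dual hp).lintegral_ball_pos hμ x hr).ne', by grind⟩
  rw [top_le_iff.1 h, ENNReal.top_mul h2, top_le_iff] at h1
  exact ENNReal.mul_ne_top ENNReal.coe_ne_top
    (ENNReal.rpow_ne_top_of_nonneg (by linarith) (hμ.measure_ball_lt_top x r).ne) h1

variable [BorelSpace X]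

lemma isDoubling_withDensity (hW : IsPosMuckenhoupt μ p W) (hp : 1 < p) (hμ : IsDoubling μ) :
    IsDoubling (μ.withDensity W) := by
  have hp0 : 0 < p := by linarith
  have hp1 : 0 < p - 1 := by linarith
  obtain ⟨C, hC⟩ := hW.exists_lintegral_mul_le hp hμ
  obtain ⟨D, -, hD⟩ := id hμ
  refine ⟨max 2 (C * D ^ p), lt_max_of_lt_left (by norm_num), fun x r hr => ?_⟩
  simp only [withDensity_apply _ measurableSet_ball]
  refine ⟨hW.lintegral_ball_pos hμ x (by positivity), ?_,
    ENNReal.mul_lt_top ENNReal.coe_lt_top (hW.lintegral_ball_lt_top hp hμ x r)⟩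
  have hm0 := (hμ.measure_ball_pos x hr).ne'
  have hmt := (hμ.measure_ball_lt_top x r).ne
  set w := ∫⁻ y in ball x r, W y ∂μ
  set w2 := ∫⁻ y in ball x (2 * r), W y ∂μ with hw2
  have hHolder : μ (ball x r) ^ p ≤ w *
      (∫⁻ y in ball x (2 * r), W y ^ (-(1 / (p - 1))) ∂μ) ^ (p - 1) := by
    have := measure_univ_rpow_le_lintegral_mul (ν := μ.restrict (ball x r)) hp
      hW.measurable.aemeasurable (.of_forall hW.ne_zero) (.of_forall hW.ne_top)
    rw [Measure.restrict_apply_univ] at this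
    refine this.trans ?_
    gcongr
    linarith
  -- Hölder on the small ball, with the dual integral enlarged to the double ball, meets the `A_p`
  -- condition there; doubling of `μ` returns to the small ball and `μ (ball x r) ^ p` cancels.
  have hkey : μ (ball x r) ^ p * w2 ≤ μ (ball x r) ^ p * (C * D ^ p * w) := by
    calc μ (ball x r) ^ p * w2
        ≤ w * (∫⁻ y in ball x (2 * r), W y ^ (-(1 / (p - 1))) ∂μ) ^ (p - 1) * w2 := by gcongr
      _ = w * (w2 * (∫⁻ y in ball x (2 * r), W y ^ (-(1 / (p - 1))) ∂μ) ^ (p - 1)) := by ring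
      _ ≤ w * (C * μ (ball x (2 * r)) ^ p) := by
          exact mul_le_mul_right (hC x (2 * r) (by positivity)) _
      _ ≤ w * (C * (D * μ (ball x r)) ^ p) := by
          gcongr
          exact (hD x r hr).2.1
      _ = _ := by
          rw [ENNReal.mul_rpow_of_nonneg _ _ hp0.le]
          ring
  have h := (ENNReal.mul_le_mul_iff_right (by simp [ENNReal.rpow_eq_zero_iff, hm0, hmt])
    (by finiteness)).1 hkey
  refine h.trans ?_
  gcongr
  rw [← ENNReal.coe_rpow_of_nonneg _ hp0.le]
  exact_mod_cast le_max_right _ _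

/-- The pointwise bound of the maximal function by weighted maximal functions. -/
lemma exists_maximal_rpow_le (hW : IsPosMuckenhoupt μ p W) (hp : 1 < p) (hμ : IsDoubling μ) :
    ∃ C : ℝ≥0, ∀ g : X → ℝ≥0∞, Measurable g → ∀ x,
      maximal μ (fun y => W y ^ (-(1 / (p - 1))) * g y) x ^ (p - 1) ≤
        C * maximal (μ.withDensity W) (fun y => (W y)⁻¹ *
          maximal (μ.withDensity fun y => W y ^ (-(1 / (p - 1)))) g y ^ (p - 1)) x := by
  have hp0 : 0 < p := by linarith
  have hp1 : 0 < p - 1 := by linarith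
  obtain ⟨C, hC⟩ := hW.exists_lintegral_mul_le hp hμ
  refine ⟨C, fun g hg x => ?_⟩
  set σ : X → ℝ≥0∞ := fun y => W y ^ (-(1 / (p - 1))) with hσ
  have hσm : Measurable σ := hW.measurable.pow_const _
  rw [← ENNReal.le_rpow_inv_iff hp1]
  refine maximal_le fun z r hx => ?_
  rw [ENNReal.le_rpow_inv_iff hp1]
  have hr := pos_of_mem_ball hx
  have hm0 := (hμ.measure_ball_pos z hr).ne'
  have hmt := (hμ.measure_ball_lt_top z r).ne
  have hV0 := (hW.lintegral_ball_pos hμ z hr).ne'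
  have hVt := (hW.lintegral_ball_lt_top hp hμ z r).ne
  have hSt := ((hW.dual hp).lintegral_ball_lt_top (by
    rw [lt_div_iff₀ hp1]; linarith) hμ z r).ne
  have hVS := hC z r hr
  refine le_trans ?_ (mul_le_mul_right (laverage_le_maximal (μ.withDensity W) _ hx) _)
  -- With `m`, `V`, `S` the masses of the ball for `μ`, `W`, `σ`, the average of `σ * g` is `S * A /
  -- m`. The condition `V * S ^ (p - 1) ≤ C * m ^ p` bounds its power `p - 1` by `C * (A ^ (p - 1) *
  -- m / V)`.
  set A := ⨍⁻ y in ball z r, g y ∂(μ.withDensity σ) with hA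
  have hf : ∫⁻ y in ball z r, σ y * g y ∂μ = (∫⁻ y in ball z r, σ y ∂μ) * A := by
    have h1 : (μ.withDensity σ) (ball z r) = ∫⁻ y in ball z r, σ y ∂μ :=
      withDensity_apply _ measurableSet_ball
    rw [← h1, hA, measure_mul_setLAverage _ (by rw [h1]; exact hSt),
      restrict_withDensity measurableSet_ball, lintegral_withDensity_eq_lintegral_mul _ hσm hg]
    rfl
  -- The maximal function for `σ` is at least `A` on the whole ball, and the density `W` cancels the
  -- factor `W⁻¹`; dividing by `V` turns the right side into a `W`-average.
  have hh : A ^ (p - 1) * μ (ball z r) ≤ ∫⁻ y in ball z r, (W y)⁻¹ *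
      maximal (μ.withDensity σ) g y ^ (p - 1) ∂(μ.withDensity W) := by
    rw [restrict_withDensity measurableSet_ball, lintegral_withDensity_eq_lintegral_mul _
      hW.measurable (by exact hW.measurable.inv.mul ((measurable_maximal _ _).pow_const _)),
      ← setLIntegral_const]
    refine setLIntegral_mono' measurableSet_ball fun y hy => ?_
    rw [Pi.mul_apply, ← mul_assoc, ENNReal.mul_inv_cancel (hW.ne_zero y) (hW.ne_top y), one_mul]
    exact ENNReal.rpow_le_rpow (laverage_le_maximal _ _ hy) hp1.le
  rw [setLAverage_eq, setLAverage_eq, hf, withDensity_apply _ measurableSet_ball]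
  change _ ≤ (C : ℝ≥0∞) * (_ / _)
  set m := μ (ball z r)
  set V := ∫⁻ y in ball z r, W y ∂μ
  set S := ∫⁻ y in ball z r, σ y ∂μ
  calc (S * A / m) ^ (p - 1) = S ^ (p - 1) * A ^ (p - 1) / m ^ (p - 1) := by
        rw [ENNReal.div_rpow_of_nonneg _ _ hp1.le, ENNReal.mul_rpow_of_nonneg _ _ hp1.le]
    _ ≤ C * (A ^ (p - 1) * m / V) := by
        have hmp0 : m ^ (p - 1) ≠ 0 := by simp [ENNReal.rpow_eq_zero_iff, hm0, hmt]
        have hmpt : m ^ (p - 1) ≠ ∞ := by finiteness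
        have hmp : m ^ p = m * m ^ (p - 1) := by
          nth_rewrite 2 [← ENNReal.rpow_one m]
          rw [← ENNReal.rpow_add _ _ hm0 hmt]
          congr 1
          ring
        rw [ENNReal.div_le_iff hmp0 hmpt, ← mul_div_assoc, ENNReal.div_eq_inv_mul, mul_assoc,
          ← ENNReal.div_eq_inv_mul, ENNReal.le_div_iff_mul_le (Or.inl hV0) (Or.inl hVt)]
        calc S ^ (p - 1) * A ^ (p - 1) * V = V * S ^ (p - 1) * A ^ (p - 1) := by ring
          _ ≤ C * m ^ p * A ^ (p - 1) := by gcongr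
          _ = _ := by rw [hmp]; ring
    _ ≤ _ := by gcongr

/-- Muckenhoupt's theorem: the maximal operator is bounded on `L ^ p (W)` for `W ∈ A_p`. -/
theorem exists_lintegral_maximal_le (hW : IsPosMuckenhoupt μ p W) (hp : 1 < p)
    (hμ : IsDoubling μ) :
    ∃ K : ℝ≥0, ∀ f : X → ℝ≥0∞, Measurable f →
      ∫⁻ x, W x * maximal μ f x ^ p ∂μ ≤ K * ∫⁻ x, W x * f x ^ p ∂μ := by
  have hp0 : 0 < p := by linarith
  have hp1 : 0 < p - 1 := by linarith
  have hp' : 1 < p / (p - 1) := by rw [lt_div_iff₀ hp1]; linarith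
  have hpp : 0 < p / (p - 1) := by positivity
  obtain ⟨C, hC⟩ := hW.exists_maximal_rpow_le hp hμ
  obtain ⟨K₁, hK₁⟩ := (hW.isDoubling_withDensity hp hμ).exists_lintegral_maximal_rpow_le hp'
  obtain ⟨K₂, hK₂⟩ := ((hW.dual hp).isDoubling_withDensity hp' hμ).exists_lintegral_maximal_rpow_le
    hp
  set σ : X → ℝ≥0∞ := fun y => W y ^ (-(1 / (p - 1))) with hσ
  have hσm : Measurable σ := hW.measurable.pow_const _
  have hσ0 : ∀ y, σ y ≠ 0 := (hW.dual hp).ne_zero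
  have hσt : ∀ y, σ y ≠ ∞ := (hW.dual hp).ne_top
  refine ⟨C ^ (p / (p - 1)) * K₁ * K₂, fun f hf => ?_⟩
  set g : X → ℝ≥0∞ := fun y => (σ y)⁻¹ * f y with hg
  have hgm : Measurable g := hσm.inv.mul hf
  have hfg : (fun y => σ y * g y) = f := by
    funext y
    rw [hg, ← mul_assoc, ENNReal.mul_inv_cancel (hσ0 y) (hσt y), one_mul]
  set h : X → ℝ≥0∞ := fun y => (W y)⁻¹ * maximal (μ.withDensity σ) g y ^ (p - 1) with hh
  have hhm : Measurable h := hW.measurable.inv.mul ((measurable_maximal _ _).pow_const _)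
  have hpt : ∀ x, maximal μ f x ^ p ≤
      (C : ℝ≥0∞) ^ (p / (p - 1)) * maximal (μ.withDensity W) h x ^ (p / (p - 1)) := by
    intro x
    have h1 := ENNReal.rpow_le_rpow (hC g hgm x) hpp.le
    rw [ENNReal.mul_rpow_of_nonneg _ _ hpp.le, ← ENNReal.rpow_mul,
      mul_div_cancel₀ _ hp1.ne'] at h1
    rw [← hfg]
    exact h1
  -- The exponents fit: `W` to the power `1 - p / (p - 1)` is `σ`, so the norm of `h` for `W`
  -- becomes the norm of the maximal function for `σ`; likewise `σ ^ (1 - p) = W` in `hσf`.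
  have hWσ : ∀ x, W x * h x ^ (p / (p - 1)) = σ x * maximal (μ.withDensity σ) g x ^ p := by
    intro x
    rw [hh, ENNReal.mul_rpow_of_nonneg _ _ hpp.le, ← ENNReal.rpow_mul,
      mul_div_cancel₀ _ hp1.ne', ← mul_assoc, ← ENNReal.rpow_neg_one, ← ENNReal.rpow_mul]
    congr 1
    nth_rewrite 1 [← ENNReal.rpow_one (W x)]
    rw [← ENNReal.rpow_add _ _ (hW.ne_zero x) (hW.ne_top x), hσ]
    congr 1
    field_simp
    ring
  have hσf : ∀ x, σ x * g x ^ p = W x * f x ^ p := by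
    intro x
    rw [hg, ENNReal.mul_rpow_of_nonneg _ _ hp0.le, ← mul_assoc, ← ENNReal.rpow_neg_one,
      ← ENNReal.rpow_mul]
    congr 1
    nth_rewrite 1 [← ENNReal.rpow_one (σ x)]
    rw [← ENNReal.rpow_add _ _ (hσ0 x) (hσt x), hσ, ← ENNReal.rpow_mul]
    nth_rewrite 2 [← ENNReal.rpow_one (W x)]
    congr 1
    field_simp
    ring
  calc ∫⁻ x, W x * maximal μ f x ^ p ∂μ
      ≤ ∫⁻ x, W x * ((C : ℝ≥0∞) ^ (p / (p - 1)) *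
          maximal (μ.withDensity W) h x ^ (p / (p - 1))) ∂μ := by
        refine lintegral_mono fun x => ?_
        gcongr
        exact hpt x
    _ = (C : ℝ≥0∞) ^ (p / (p - 1)) *
          ∫⁻ x, maximal (μ.withDensity W) h x ^ (p / (p - 1)) ∂(μ.withDensity W) := by
        rw [lintegral_withDensity_eq_lintegral_mul _ hW.measurable
          ((measurable_maximal _ _).pow_const _), ← lintegral_const_mul' _ _ (by finiteness)]
        refine lintegral_congr fun x => ?_
        rw [Pi.mul_apply]
        ring
    _ ≤ (C : ℝ≥0∞) ^ (p / (p - 1)) *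
          (K₁ * ∫⁻ x, h x ^ (p / (p - 1)) ∂(μ.withDensity W)) := by
        gcongr
        exact hK₁ h hhm
    _ = (C : ℝ≥0∞) ^ (p / (p - 1)) *
          (K₁ * ∫⁻ x, maximal (μ.withDensity σ) g x ^ p ∂(μ.withDensity σ)) := by
        rw [lintegral_withDensity_eq_lintegral_mul _ hW.measurable (hhm.pow_const _),
          lintegral_withDensity_eq_lintegral_mul _ hσm ((measurable_maximal _ _).pow_const _)]
        simp only [Pi.mul_apply, hWσ]
    _ ≤ (C : ℝ≥0∞) ^ (p / (p - 1)) *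
          (K₁ * (K₂ * ∫⁻ x, g x ^ p ∂(μ.withDensity σ))) := by
        gcongr
        exact hK₂ g hgm
    _ = _ := by
        rw [lintegral_withDensity_eq_lintegral_mul _ hσm (hgm.pow_const _)]
        simp only [Pi.mul_apply, hσf]
        rw [ENNReal.coe_mul, ENNReal.coe_mul, ENNReal.coe_rpow_of_nonneg _ hpp.le]
        ring

end IsPosMuckenhoupt

/-! ### Minkowski's inequality for series -/

section Minkowski

variable {Y : Type*} [MeasurableSpace Y] {ν : Measure Y}

lemma lintegral_Lp_sum_range_le {t : ℝ} (ht : 1 ≤ t) {f : ℕ → Y → ℝ≥0∞}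
    (hf : ∀ k, Measurable (f k)) (n : ℕ) :
    (∫⁻ y, (∑ k ∈ Finset.range n, f k y) ^ t ∂ν) ^ (1 / t) ≤
      ∑ k ∈ Finset.range n, (∫⁻ y, f k y ^ t ∂ν) ^ (1 / t) := by
  have ht0 : 0 < t := by linarith
  induction n with
  | zero => simp [ENNReal.zero_rpow_of_pos ht0, ENNReal.zero_rpow_of_pos (inv_pos.2 ht0)]
  | succ n ih =>
    simp only [Finset.sum_range_succ]
    refine (ENNReal.lintegral_Lp_add_le (f := fun y => ∑ k ∈ Finset.range n, f k y)
      (Finset.measurable_fun_sum _ fun k _ => hf k).aemeasurable (hf n).aemeasurable ht).trans ?_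
    gcongr

lemma lintegral_tsum_rpow_le {t : ℝ} (ht : 1 ≤ t) {f : ℕ → Y → ℝ≥0∞}
    (hf : ∀ k, Measurable (f k)) :
    ∫⁻ y, (∑' k, f k y) ^ t ∂ν ≤ (∑' k, (∫⁻ y, f k y ^ t ∂ν) ^ (1 / t)) ^ t := by
  have ht0 : 0 < t := by linarith
  have hsup : ∀ y, (∑' k, f k y) ^ t = ⨆ n : ℕ, (∑ k ∈ Finset.range n, f k y) ^ t := by
    intro y
    rw [ENNReal.tsum_eq_iSup_nat]
    exact (ENNReal.orderIsoRpow t ht0).map_iSup _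
  simp only [hsup]
  rw [lintegral_iSup (fun n => (Finset.measurable_fun_sum _ fun k _ => hf k).pow_const t)]
  · refine iSup_le fun n => ?_
    rw [← ENNReal.rpow_inv_le_iff ht0, ← one_div]
    exact (lintegral_Lp_sum_range_le ht hf n).trans (ENNReal.sum_le_tsum _)
  · intro m n hmn y
    exact ENNReal.rpow_le_rpow (Finset.sum_le_sum_of_subset (Finset.range_mono hmn)) ht0.le

end Minkowski

/-! ### The Rubio de Francia iteration -/

/-- If `T` is countably sublinear and bounded on `L ^ q`, then there is a function in `L ^ q`
above a given one on which `T` is bounded pointwise by a multiple. -/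
lemma exists_majorant_of_sublinear {Y : Type*} [MeasurableSpace Y] {ν : Measure Y} {q : ℝ}
    (hq : 1 ≤ q) {T : (Y → ℝ≥0∞) → Y → ℝ≥0∞} (hTm : ∀ f, Measurable f → Measurable (T f))
    (hT : ∀ (c : ℕ → ℝ≥0) (f : ℕ → Y → ℝ≥0∞), (∀ k, Measurable (f k)) → ∀ y,
      T (fun y => ∑' k, c k * f k y) y ≤ ∑' k, c k * T (f k) y)
    {A : ℝ≥0} (hA : ∀ f, Measurable f →
      (∫⁻ y, T f y ^ q ∂ν) ^ (1 / q) ≤ A * (∫⁻ y, f y ^ q ∂ν) ^ (1 / q))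
    {f : Y → ℝ≥0∞} (hf : Measurable f) (hfq : ∫⁻ y, f y ^ q ∂ν ≠ ∞) :
    ∃ η : Y → ℝ≥0∞, Measurable η ∧ (∀ y, f y ≤ η y) ∧ ∫⁻ y, η y ^ q ∂ν ≠ ∞ ∧
      ∃ C : ℝ≥0, ∀ y, T η y ≤ C * η y := by
  have hq0 : 0 < q := by linarith
  -- The majorant is the Neumann-type series `∑ (2B)⁻ᵏ Tᵏ f`: its norms decay like `2⁻ᵏ`, and
  -- applying `T` shifts the series at the cost of a factor `2B`. The maximum with `1` keeps `B`
  -- invertible.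
  set B : ℝ≥0 := max A 1
  have hB0 : B ≠ 0 := (lt_of_lt_of_le one_pos (le_max_right A 1)).ne'
  set c : ℝ≥0 := (2 * B)⁻¹
  have hc0 : (2 * B) * c = 1 := mul_inv_cancel₀ (by positivity)
  have hm : ∀ k, Measurable (T^[k] f) := by
    intro k
    induction k with
    | zero => exact hf
    | succ k ih => rw [Function.iterate_succ_apply']; exact hTm _ ih
  have hnorm : ∀ k, (∫⁻ y, T^[k] f y ^ q ∂ν) ^ (1 / q) ≤
      (B : ℝ≥0∞) ^ k * (∫⁻ y, f y ^ q ∂ν) ^ (1 / q) := by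
    intro k
    induction k with
    | zero => simp
    | succ k ih =>
      rw [Function.iterate_succ_apply', pow_succ', mul_assoc]
      refine (hA _ (hm k)).trans ?_
      gcongr
      exact le_max_left _ _
  refine ⟨fun y => ∑' k, (c ^ k : ℝ≥0) * T^[k] f y,
    Measurable.tsum fun k => (hm k).const_mul _, fun y => ?_, ?_, 2 * B, fun y => ?_⟩
  · refine le_trans ?_ (ENNReal.le_tsum 0)
    simp
  · refine ne_top_of_le_ne_top ?_ (lintegral_tsum_rpow_le hq fun k => (hm k).const_mul _)
    refine ENNReal.rpow_ne_top_of_nonneg hq0.le ?_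
    have hterm : ∀ k, (∫⁻ y, ((c ^ k : ℝ≥0) * T^[k] f y) ^ q ∂ν) ^ (1 / q) ≤
        (2⁻¹ : ℝ≥0∞) ^ k * (∫⁻ y, f y ^ q ∂ν) ^ (1 / q) := by
      intro k
      simp only [ENNReal.mul_rpow_of_nonneg _ _ hq0.le]
      rw [lintegral_const_mul _ ((hm k).pow_const q),
        ENNReal.mul_rpow_of_nonneg _ _ (one_div_nonneg.2 hq0.le), ← ENNReal.rpow_mul,
        mul_one_div_cancel hq0.ne', ENNReal.rpow_one]
      calc _ ≤ ((c ^ k : ℝ≥0) : ℝ≥0∞) * ((B : ℝ≥0∞) ^ k * (∫⁻ y, f y ^ q ∂ν) ^ (1 / q)) := by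
            gcongr
            exact hnorm k
        _ = _ := by
            rw [← mul_assoc, ENNReal.coe_pow, ← mul_pow]
            congr 2
            rw [← ENNReal.coe_mul, show c * B = 2⁻¹ by
              have : c * B * 2 = 1 := by rw [← hc0]; ring
              exact eq_inv_of_mul_eq_one_left this]
            simp
    refine ne_top_of_le_ne_top ?_ (ENNReal.tsum_le_tsum hterm)
    rw [ENNReal.tsum_mul_right, ENNReal.tsum_geometric]
    refine ENNReal.mul_ne_top ?_ (ENNReal.rpow_ne_top_of_nonneg (one_div_nonneg.2 hq0.le) hfq)
    simp
  · refine (hT (fun k => c ^ k) _ hm y).trans ?_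
    calc ∑' k, ((c ^ k : ℝ≥0) : ℝ≥0∞) * T (T^[k] f) y
        = ∑' k, ((2 * B : ℝ≥0) : ℝ≥0∞) * ((c ^ (k + 1) : ℝ≥0) * T^[k + 1] f y) := by
          refine tsum_congr fun k => ?_
          rw [Function.iterate_succ_apply', ← mul_assoc, ← ENNReal.coe_mul, pow_succ',
            ← mul_assoc, hc0, one_mul]
      _ ≤ _ := by
          rw [ENNReal.tsum_mul_left]
          gcongr
          exact ENNReal.tsum_comp_le_tsum_of_injective (add_left_injective 1)
            (fun k => ((c ^ k : ℝ≥0) : ℝ≥0∞) * T^[k] f y)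

/-! ### Factorization of Muckenhoupt weights -/

/-- The operator `f ↦ (a⁻¹ M (a f ^ t)) ^ (1 / t)`. -/
noncomputable def weightedMaximal (μ : Measure X) (a : X → ℝ≥0∞) (t : ℝ) (f : X → ℝ≥0∞)
    (x : X) : ℝ≥0∞ :=
  ((a x)⁻¹ * maximal μ (fun y => a y * f y ^ t) x) ^ (1 / t)

lemma measurable_weightedMaximal [BorelSpace X] (μ : Measure X) {a : X → ℝ≥0∞}
    (ha : Measurable a) (t : ℝ) (f : X → ℝ≥0∞) : Measurable (weightedMaximal μ a t f) :=
  (ha.inv.mul (measurable_maximal μ _)).pow_const _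

lemma weightedMaximal_le_iff {μ : Measure X} {a : X → ℝ≥0∞} {t : ℝ} (ht : 0 < t)
    (ha0 : ∀ x, a x ≠ 0) (hat : ∀ x, a x ≠ ∞) {f : X → ℝ≥0∞} {x : X} {R : ℝ≥0∞} :
    weightedMaximal μ a t f x ≤ R ↔ maximal μ (fun y => a y * f y ^ t) x ≤ a x * R ^ t := by
  rw [weightedMaximal, one_div, ENNReal.rpow_inv_le_iff ht, ← ENNReal.div_eq_inv_mul,
    ENNReal.div_le_iff (ha0 x) (hat x), mul_comm]

/-- On each ball the operator takes an `L ^ t` norm for a normalised measure, so Minkowski's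
inequality gives sublinearity; this is where `1 ≤ t` enters. -/
lemma weightedMaximal_tsum_le {μ : Measure X} {a : X → ℝ≥0∞} {t : ℝ} (ht : 1 ≤ t)
    (ha : Measurable a) (ha0 : ∀ x, a x ≠ 0) (hat : ∀ x, a x ≠ ∞) (c : ℕ → ℝ≥0)
    {f : ℕ → X → ℝ≥0∞} (hf : ∀ k, Measurable (f k)) (x : X) :
    weightedMaximal μ a t (fun y => ∑' k, c k * f k y) x ≤
      ∑' k, c k * weightedMaximal μ a t (f k) x := by
  have ht0 : 0 < t := by linarith
  have hti : 0 ≤ 1 / t := by positivity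
  have hroot : ∀ z : ℝ≥0∞, (z ^ (1 / t)) ^ t = z := fun z => by
    rw [← ENNReal.rpow_mul, one_div_mul_cancel ht0.ne', ENNReal.rpow_one]
  have hroot' : ∀ z : ℝ≥0∞, (z ^ t) ^ (1 / t) = z := fun z => by
    rw [← ENNReal.rpow_mul, mul_one_div_cancel ht0.ne', ENNReal.rpow_one]
  rw [weightedMaximal_le_iff ht0 ha0 hat]
  refine maximal_le fun z r hx => ?_
  rw [laverage_eq']
  set ν := ((μ.restrict (ball z r)) univ)⁻¹ • μ.restrict (ball z r) with hν
  calc ∫⁻ y, a y * (∑' k, c k * f k y) ^ t ∂ν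
      = ∫⁻ y, (∑' k, a y ^ (1 / t) * (c k * f k y)) ^ t ∂ν := by
        refine lintegral_congr fun y => ?_
        rw [ENNReal.tsum_mul_left, ENNReal.mul_rpow_of_nonneg _ _ ht0.le, hroot]
    _ ≤ (∑' k, (∫⁻ y, (a y ^ (1 / t) * (c k * f k y)) ^ t ∂ν) ^ (1 / t)) ^ t :=
        lintegral_tsum_rpow_le ht fun k => (ha.pow_const _).mul ((hf k).const_mul _)
    _ ≤ (∑' k, a x ^ (1 / t) * (c k * weightedMaximal μ a t (f k) x)) ^ t := by
        refine ENNReal.rpow_le_rpow (ENNReal.tsum_le_tsum fun k => ?_) ht0.le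
        have h1 : ∀ y, (a y ^ (1 / t) * (c k * f k y)) ^ t =
            (c k : ℝ≥0∞) ^ t * (a y * f k y ^ t) := fun y => by
          rw [ENNReal.mul_rpow_of_nonneg _ _ ht0.le, ENNReal.mul_rpow_of_nonneg _ _ ht0.le, hroot]
          ring
        simp only [h1]
        rw [lintegral_const_mul' _ _ (by finiteness),
          ENNReal.mul_rpow_of_nonneg _ _ hti, hroot', mul_left_comm]
        gcongr
        rw [weightedMaximal, ← ENNReal.mul_rpow_of_nonneg _ _ hti, ← mul_assoc,
          ENNReal.mul_inv_cancel (ha0 x) (hat x), one_mul]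
        refine ENNReal.rpow_le_rpow ?_ hti
        exact laverage_le_maximal μ (fun y => a y * f k y ^ t) hx
    _ = _ := by
        rw [ENNReal.tsum_mul_left, ENNReal.mul_rpow_of_nonneg _ _ ht0.le, hroot]

/-- The `q`-th power of the operator is `a ^ (-(q / t)) * M (a f ^ t) ^ (q / t)`. Muckenhoupt's
theorem in `L ^ (q / t)` with weight `a ^ (-(q / t))` applies, and that weight cancels against `a`
to leave `f ^ q`. -/
lemma exists_weightedMaximal_Lp_le [BorelSpace X] {μ : Measure X} (hμ : IsDoubling μ)
    {a : X → ℝ≥0∞} {t q : ℝ} (ht : 0 < t) (htq : t < q) (ha : Measurable a)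
    (ha0 : ∀ x, a x ≠ 0) (hat : ∀ x, a x ≠ ∞)
    (hW : IsPosMuckenhoupt μ (q / t) fun x => a x ^ (-(q / t))) :
    ∃ A : ℝ≥0, ∀ f, Measurable f →
      (∫⁻ x, weightedMaximal μ a t f x ^ q ∂μ) ^ (1 / q) ≤ A * (∫⁻ x, f x ^ q ∂μ) ^ (1 / q) := by
  have hq : 0 < q := ht.trans htq
  have hqt : 0 < q / t := by positivity
  obtain ⟨K, hK⟩ := hW.exists_lintegral_maximal_le ((one_lt_div ht).2 htq) hμ
  refine ⟨K ^ (1 / q), fun f hf => ?_⟩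
  have h := hK (fun y => a y * f y ^ t) (ha.mul (hf.pow_const t))
  have h1 : ∀ x, weightedMaximal μ a t f x ^ q =
      a x ^ (-(q / t)) * maximal μ (fun y => a y * f y ^ t) x ^ (q / t) := fun x => by
    rw [weightedMaximal, ← ENNReal.rpow_mul, ENNReal.mul_rpow_of_nonneg _ _ (by positivity),
      ← ENNReal.rpow_neg_one, ← ENNReal.rpow_mul]
    congr 2 <;> ring
  have h2 : ∀ x, a x ^ (-(q / t)) * (a x * f x ^ t) ^ (q / t) = f x ^ q := fun x => by
    rw [ENNReal.mul_rpow_of_nonneg _ _ hqt.le, ← mul_assoc, ← ENNReal.rpow_add _ _ (ha0 x) (hat x),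
      neg_add_cancel, ENNReal.rpow_zero, one_mul, ← ENNReal.rpow_mul, mul_div_cancel₀ _ ht.ne']
  simp only [h2] at h
  simp only [h1]
  rw [ENNReal.coe_rpow_of_nonneg _ (by positivity), ← ENNReal.mul_rpow_of_nonneg _ _ (by positivity)]
  exact ENNReal.rpow_le_rpow h (by positivity)

/-- A measurable positive weight, finite almost everywhere, of class `A_1`. -/
structure IsPosMuckenhouptOne (μ : Measure X) (v : X → ℝ≥0∞) : Prop where
  measurable : Measurable v
  ne_zero : ∀ x, v x ≠ 0
  ae_ne_top : ∀ᵐ x ∂μ, v x ≠ ∞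
  bound : ∃ C : ℝ≥0, ∀ x, maximal μ v x ≤ C * v x

/-- Raising the hypothesis to the power `t` and clearing `a⁻¹` gives exactly the `A_1` inequality,
with constant `C ^ t`. -/
lemma isPosMuckenhouptOne_of_weightedMaximal_le {μ : Measure X} {a η : X → ℝ≥0∞} {t : ℝ}
    (ht : 0 < t) (ha : Measurable a) (ha0 : ∀ x, a x ≠ 0) (hat : ∀ x, a x ≠ ∞)
    (hη : Measurable η) (hη0 : ∀ x, η x ≠ 0) (hηt : ∀ᵐ x ∂μ, η x ≠ ∞) {C : ℝ≥0}
    (hC : ∀ x, weightedMaximal μ a t η x ≤ C * η x) :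
    IsPosMuckenhouptOne μ fun x => a x * η x ^ t where
  measurable := ha.mul (hη.pow_const t)
  ne_zero x := mul_ne_zero (ha0 x) (by simp [ENNReal.rpow_eq_zero_iff, hη0 x, ht.le])
  ae_ne_top := by
    filter_upwards [hηt] with x hx
    exact ENNReal.mul_ne_top (hat x) (ENNReal.rpow_ne_top_of_nonneg ht.le hx)
  bound := by
    refine ⟨C ^ t, fun x => ?_⟩
    have := (weightedMaximal_le_iff ht ha0 hat).1 (hC x)
    rw [ENNReal.mul_rpow_of_nonneg _ _ ht.le] at this
    rw [ENNReal.coe_rpow_of_nonneg _ ht.le]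
    exact this.trans (le_of_eq (by ring))

/-- One `η` controls both summands of the operator, so `W ^ (1 / q) * η ^ (q - 1)` and `W ^ (-(1 /
q)) * η` are both `A_1`; in the quotient `η` cancels and `W` remains. The condition `2 ≤ q` makes
the inner exponent `q - 1` at least `1`. -/
lemma IsPosMuckenhoupt.exists_factorization_of_two_le [BorelSpace X] {μ : Measure X}
    (hμ : IsDoubling μ) {q : ℝ} (hq : 2 ≤ q) {W : X → ℝ≥0∞} (hW : IsPosMuckenhoupt μ q W) :
    ∃ v₁ v₂ : X → ℝ≥0∞, IsPosMuckenhouptOne μ v₁ ∧ IsPosMuckenhouptOne μ v₂ ∧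
      ∀ᵐ x ∂μ, W x = v₁ x * v₂ x ^ (1 - q) := by
  have := hμ.sigmaFinite
  have hq0 : 0 < q := by linarith
  have hq1 : 0 < q - 1 := by linarith
  set a : X → ℝ≥0∞ := fun x => W x ^ (1 / q) with ha
  set b : X → ℝ≥0∞ := fun x => W x ^ (-(1 / q)) with hb
  have ham : Measurable a := hW.measurable.pow_const _
  have hbm : Measurable b := hW.measurable.pow_const _
  have ha0 : ∀ x, a x ≠ 0 := fun x => by simp [ha, ENNReal.rpow_eq_zero_iff, hW.ne_zero, hW.ne_top]
  have hat : ∀ x, a x ≠ ∞ := fun x => by simp [ha, ENNReal.rpow_eq_top_iff, hW.ne_zero, hW.ne_top]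
  have hb0 : ∀ x, b x ≠ 0 := fun x => by simp [hb, ENNReal.rpow_eq_zero_iff, hW.ne_zero, hW.ne_top]
  have hbt : ∀ x, b x ≠ ∞ := fun x => by simp [hb, ENNReal.rpow_eq_top_iff, hW.ne_zero, hW.ne_top]
  obtain ⟨A, hA⟩ := exists_weightedMaximal_Lp_le hμ (a := a) (t := q - 1) (q := q) hq1
    (by linarith) ham ha0 hat (by
      convert hW.dual (by linarith) using 2 with x
      rw [ha, ← ENNReal.rpow_mul]
      congr 1
      field_simp)
  obtain ⟨A', hA'⟩ := exists_weightedMaximal_Lp_le hμ (a := b) (t := 1) (q := q) one_pos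
    (by linarith) hbm hb0 hbt (by
      convert hW using 2 with x
      · simp
      · rw [hb, ← ENNReal.rpow_mul]
        convert ENNReal.rpow_one _ using 2
        field_simp)
  -- A strictly positive integrable seed: `g ^ (1 / q)` lies in `L ^ q` and forces `η` to be
  -- positive everywhere.
  obtain ⟨g, hg0, hgm, hgi⟩ := exists_pos_lintegral_lt_of_sigmaFinite μ (ε := 1) one_ne_zero
  obtain ⟨η, hηm, hfη, hηi, C, hC⟩ := exists_majorant_of_sublinear (ν := μ) (q := q)
    (by linarith) (T := fun f x => weightedMaximal μ a (q - 1) f x + weightedMaximal μ b 1 f x)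
    (fun f _ => (measurable_weightedMaximal μ ham _ f).add (measurable_weightedMaximal μ hbm _ f))
    (fun c f hf x => by
      simp only [mul_add]
      rw [ENNReal.tsum_add]
      exact add_le_add (weightedMaximal_tsum_le (by linarith) ham ha0 hat c hf x)
        (weightedMaximal_tsum_le le_rfl hbm hb0 hbt c hf x))
    (A := A + A')
    (fun f hf => by
      refine (ENNReal.lintegral_Lp_add_le (measurable_weightedMaximal μ ham _ f).aemeasurable
        (measurable_weightedMaximal μ hbm _ f).aemeasurable (by linarith)).trans ?_
      rw [ENNReal.coe_add, add_mul]
      exact add_le_add (hA f hf) (hA' f hf))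
    (f := fun x => (g x : ℝ≥0∞) ^ (1 / q)) (hgm.coe_nnreal_ennreal.pow_const _)
    (by
      have : ∀ x, ((g x : ℝ≥0∞) ^ (1 / q)) ^ q = g x := fun x => by
        rw [← ENNReal.rpow_mul, one_div_mul_cancel hq0.ne', ENNReal.rpow_one]
      simp only [this]
      exact (hgi.trans ENNReal.one_lt_top).ne)
  have hη0 : ∀ x, η x ≠ 0 := fun x => by
    refine (lt_of_lt_of_le (ENNReal.rpow_pos ?_ ENNReal.coe_ne_top) (hfη x)).ne'
    exact_mod_cast hg0 x
  have hηt : ∀ᵐ x ∂μ, η x ≠ ∞ := by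
    filter_upwards [ae_lt_top (hηm.pow_const q) hηi] with x hx h
    simp [h, ENNReal.top_rpow_of_pos hq0] at hx
  refine ⟨_, _, isPosMuckenhouptOne_of_weightedMaximal_le hq1 ham ha0 hat hηm hη0 hηt
    (fun x => le_self_add.trans (hC x)), isPosMuckenhouptOne_of_weightedMaximal_le one_pos hbm hb0
    hbt hηm hη0 hηt (fun x => le_add_self.trans (hC x)), ?_⟩
  filter_upwards [hηt] with x hx
  have hW0 := hW.ne_zero x
  have hWt := hW.ne_top x
  rw [ENNReal.rpow_one, ENNReal.mul_rpow_of_ne_top (hbt x) hx, mul_mul_mul_comm,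
    ← ENNReal.rpow_add _ _ (hη0 x) hx, ha, hb, ← ENNReal.rpow_mul, ← ENNReal.rpow_add _ _ hW0 hWt,
    show 1 / q + -(1 / q) * (1 - q) = 1 by field_simp; ring, show q - 1 + (1 - q) = 0 by ring,
    ENNReal.rpow_one, ENNReal.rpow_zero, mul_one]

/-- Jones' factorization theorem. -/
theorem IsPosMuckenhoupt.exists_factorization [BorelSpace X] {μ : Measure X}
    (hμ : IsDoubling μ) {q : ℝ} (hq : 1 < q) {W : X → ℝ≥0∞} (hW : IsPosMuckenhoupt μ q W) :
    ∃ v₁ v₂ : X → ℝ≥0∞, IsPosMuckenhouptOne μ v₁ ∧ IsPosMuckenhouptOne μ v₂ ∧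
      ∀ᵐ x ∂μ, W x = v₁ x * v₂ x ^ (1 - q) := by
  have hq1 : 0 < q - 1 := by linarith
  rcases le_or_gt 2 q with h2 | h2
  · exact hW.exists_factorization_of_two_le hμ h2
  -- For `q < 2` the conjugate exponent exceeds `2`. Raising the factorization of the dual weight to
  -- the power `1 - q` exchanges the two factors, since `(1 - q / (q - 1)) * (1 - q) = 1`.
  · obtain ⟨v₁, v₂, h₁, h₂, h⟩ := (hW.dual hq).exists_factorization_of_two_le hμ
      (by rw [le_div_iff₀ hq1]; linarith)
    refine ⟨v₂, v₁, h₂, h₁, ?_⟩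
    filter_upwards [h, h₁.ae_ne_top, h₂.ae_ne_top] with x hx ht₁ ht₂
    have h3 : W x = (W x ^ (-(1 / (q - 1)))) ^ (1 - q) := by
      rw [← ENNReal.rpow_mul, show -(1 / (q - 1)) * (1 - q) = 1 by field_simp; ring,
        ENNReal.rpow_one]
    have h4 : v₂ x ^ (1 - q / (q - 1)) ≠ ∞ := by
      simp [ENNReal.rpow_eq_top_iff, h₂.ne_zero x, ht₂]
    rw [h3, hx, ENNReal.mul_rpow_of_ne_top ht₁ h4, ← ENNReal.rpow_mul,
      show (1 - q / (q - 1)) * (1 - q) = 1 by field_simp; ring, ENNReal.rpow_one, mul_comm]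

/-! ### Averages and weights -/

section Average

variable {Y : Type*} [MeasurableSpace Y] {ν : Measure Y}

lemma laverage_const_mul (f : Y → ℝ≥0∞) {c : ℝ≥0∞} (hc : c ≠ ∞) :
    ⨍⁻ y, c * f y ∂ν = c * ⨍⁻ y, f y ∂ν := by
  rw [laverage_eq', laverage_eq', lintegral_const_mul' _ _ hc]

/-- Jensen for a concave power, obtained from Hölder against the constant `1` in the normalised
measure. -/
lemma laverage_rpow_le {v : Y → ℝ≥0∞} (hv : AEMeasurable v ν) {s : ℝ} (hs : 1 < s)
    (h0 : ν univ ≠ 0) (ht : ν univ ≠ ∞) :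
    ⨍⁻ y, v y ^ (1 / s) ∂ν ≤ (⨍⁻ y, v y ∂ν) ^ (1 / s) := by
  have hs0 : 0 < s := by linarith
  have h := ENNReal.lintegral_mul_le_Lp_mul_Lq ((ν univ)⁻¹ • ν)
    (Real.HolderConjugate.conjExponent hs)
    ((hv.pow_const (1 / s)).smul_measure _) (aemeasurable_const (b := (1 : ℝ≥0∞)))
  have h2 : ∀ y, (v y ^ s⁻¹) ^ s = v y := fun y => ENNReal.rpow_inv_rpow hs0.ne' _
  simpa [h2, ENNReal.inv_mul_cancel h0 ht, laverage_eq', -lintegral_smul_measure] using h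

/-- The constant `C + 1` keeps the divisor nonzero. -/
lemma le_mul_essInf {f : Y → ℝ≥0∞} {A : ℝ≥0∞} {C : ℝ≥0} (h : ∀ᵐ y ∂ν, A ≤ C * f y) :
    A ≤ (C + 1 : ℝ≥0) * essInf f ν := by
  have h0 : ((C + 1 : ℝ≥0) : ℝ≥0∞) ≠ 0 := by simp
  rw [mul_comm, ← ENNReal.div_le_iff h0 ENNReal.coe_ne_top]
  refine le_essInf_of_ae_le _ ?_
  filter_upwards [h] with y hy
  rw [ENNReal.div_le_iff h0 ENNReal.coe_ne_top, mul_comm]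
  refine hy.trans ?_
  gcongr
  simp

end Average

lemma isWeight_of_lintegral_lt_top {μ : Measure X} {w : X → ℝ} (hw : AEStronglyMeasurable w μ)
    (h0 : 0 ≤ᵐ[μ] w) (h : ∀ x r, 0 < r → ∫⁻ y in ball x r, ENNReal.ofReal (w y) ∂μ < ∞) :
    IsWeight μ w := by
  refine ⟨h0, fun x => ⟨ball x 1, ball_mem_nhds x one_pos, hw.restrict, ?_⟩⟩
  rw [hasFiniteIntegral_iff_ofReal (ae_restrict_of_ae h0)]
  exact h x 1 one_pos

lemma ofReal_toReal_ae_eq {Y : Type*} [MeasurableSpace Y] {ν : Measure Y} {F : Y → ℝ≥0∞}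
    (hF : ∀ᵐ y ∂ν, F y ≠ ∞) : (fun y => ENNReal.ofReal (F y).toReal) =ᵐ[ν] F := by
  filter_upwards [hF] with y hy using ENNReal.ofReal_toReal hy

lemma isWeight_toReal {μ : Measure X} {F : X → ℝ≥0∞} (hF : Measurable F)
    (ht : ∀ᵐ x ∂μ, F x ≠ ∞) (h : ∀ x r, 0 < r → ∫⁻ y in ball x r, F y ∂μ < ∞) :
    IsWeight μ fun x => (F x).toReal := by
  refine isWeight_of_lintegral_lt_top hF.ennreal_toReal.aestronglyMeasurable
    (.of_forall fun x => ENNReal.toReal_nonneg) fun x r hr => ?_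
  rw [lintegral_congr_ae (ae_restrict_of_ae (ofReal_toReal_ae_eq ht))]
  exact h x r hr

/-! ### Powers of `A_1` weights -/

namespace IsPosMuckenhouptOne

variable {μ : Measure X} {v : X → ℝ≥0∞}

lemma exists_laverage_le (hv : IsPosMuckenhouptOne μ v) :
    ∃ C : ℝ≥0, ∀ x r, ∀ y ∈ ball x r, ⨍⁻ z in ball x r, v z ∂μ ≤ C * v y := by
  obtain ⟨C, hC⟩ := hv.bound
  exact ⟨C, fun x r y hy => (laverage_le_maximal μ v hy).trans (hC y)⟩

lemma laverage_ne_zero (hv : IsPosMuckenhouptOne μ v) (hμ : IsDoubling μ) (x : X) {r : ℝ}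
    (hr : 0 < r) : ⨍⁻ z in ball x r, v z ∂μ ≠ 0 := by
  rw [setLAverage_eq]
  refine (ENNReal.div_pos ?_ (hμ.measure_ball_lt_top x r).ne).ne'
  refine ((setLIntegral_pos_iff hv.measurable).2 ?_).ne'
  rw [eq_univ_of_forall (s := Function.support v) hv.ne_zero, univ_inter]
  exact hμ.measure_ball_pos x hr

variable [BorelSpace X]

lemma laverage_ne_top (hv : IsPosMuckenhouptOne μ v) (hμ : IsDoubling μ) (x : X) {r : ℝ}
    (hr : 0 < r) : ⨍⁻ z in ball x r, v z ∂μ ≠ ∞ := by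
  obtain ⟨C, hC⟩ := hv.exists_laverage_le
  have hne : (ae (μ.restrict (ball x r))).NeBot := by
    rw [ae_restrict_neBot]
    exact (hμ.measure_ball_pos x hr).ne'
  obtain ⟨y, hyt, hy⟩ :=
    ((ae_restrict_of_ae (s := ball x r) hv.ae_ne_top).and
      (ae_restrict_mem measurableSet_ball)).exists
  exact ne_top_of_le_ne_top (ENNReal.mul_ne_top ENNReal.coe_ne_top hyt) (hC x r y hy)

/-- The power `v ^ (1 / s)` of an `A_1` weight is of class `A_1 ∩ RH_s`. -/
theorem rpow_one_div (hv : IsPosMuckenhouptOne μ v) (hμ : IsDoubling μ) {s : ℝ} (hs : 1 < s) :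
    MuckenhouptAOne μ (fun x => (v x ^ (1 / s)).toReal) ∧
      ReverseHolder μ s (fun x => (v x ^ (1 / s)).toReal) := by
  have hs0 : 0 < s := by linarith
  have hsi : 0 ≤ 1 / s := by positivity
  obtain ⟨C, hC⟩ := hv.exists_laverage_le
  have htop : ∀ᵐ x ∂μ, v x ^ (1 / s) ≠ ∞ := by
    filter_upwards [hv.ae_ne_top] with x hx using ENNReal.rpow_ne_top_of_nonneg hsi hx
  have hae := ofReal_toReal_ae_eq htop
  have hres : ∀ x r, (fun y => ENNReal.ofReal (v y ^ (1 / s)).toReal) =ᵐ[μ.restrict (ball x r)]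
      fun y => v y ^ (1 / s) := fun x r => ae_restrict_of_ae hae
  have hJ : ∀ x r, 0 < r → ⨍⁻ y in ball x r, v y ^ (1 / s) ∂μ ≤
      (⨍⁻ y in ball x r, v y ∂μ) ^ (1 / s) := fun x r hr =>
    laverage_rpow_le hv.measurable.aemeasurable hs
      (by rw [Measure.restrict_apply_univ]; exact (hμ.measure_ball_pos x hr).ne')
      (by rw [Measure.restrict_apply_univ]; exact (hμ.measure_ball_lt_top x r).ne)
  -- The root of the `A_1` condition for `v`. Combined with Jensen it is the `A_1` condition for the
  -- root; averaged over the ball it is the reverse Hölder inequality.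
  have hpt : ∀ x r, ∀ y ∈ ball x r, (⨍⁻ y in ball x r, v y ∂μ) ^ (1 / s) ≤
      ((C ^ (1 / s) : ℝ≥0) : ℝ≥0∞) * v y ^ (1 / s) := fun x r y hy => by
    rw [ENNReal.coe_rpow_of_nonneg _ hsi, ← ENNReal.mul_rpow_of_nonneg _ _ hsi]
    exact ENNReal.rpow_le_rpow (hC x r y hy) hsi
  have hweight : IsWeight μ fun x => (v x ^ (1 / s)).toReal := by
    refine isWeight_toReal (hv.measurable.pow_const _) htop fun x r hr => ?_
    have hmt := (hμ.measure_ball_lt_top x r).ne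
    rw [← measure_mul_setLAverage _ hmt]
    exact ENNReal.mul_lt_top hmt.lt_top ((hJ x r hr).trans_lt
      (ENNReal.rpow_lt_top_of_nonneg hsi (hv.laverage_ne_top hμ x hr)))
  refine ⟨⟨hweight, C ^ (1 / s) + 1, fun x r hr => ?_⟩, hweight, C ^ (1 / s), fun x r hr => ?_⟩
  · rw [laverage_congr (hres x r), essInf_congr_ae (hres x r)]
    refine le_mul_essInf ?_
    filter_upwards [ae_restrict_mem measurableSet_ball] with y hy
    exact (hJ x r hr).trans (hpt x r y hy)
  · have hm0 := (hμ.measure_ball_pos x hr).ne'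
    have hmt := (hμ.measure_ball_lt_top x r).ne
    have h1 : (fun y => ENNReal.ofReal (v y ^ (1 / s)).toReal ^ s) =ᵐ[μ.restrict (ball x r)] v := by
      filter_upwards [hres x r] with y hy
      rw [hy, ← ENNReal.rpow_mul, one_div_mul_cancel hs0.ne', ENNReal.rpow_one]
    rw [laverage_congr (hres x r), laverage_congr h1, ← laverage_const_mul _ ENNReal.coe_ne_top,
      ← setLAverage_const hm0 hmt ((⨍⁻ y in ball x r, v y ∂μ) ^ (1 / s))]
    refine laverage_mono_ae ?_
    filter_upwards [ae_restrict_mem measurableSet_ball] with y hy using hpt x r y hy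

/-- The power `v ^ (1 - p)` of an `A_1` weight is of class `A_p ∩ RH_∞`. -/
theorem rpow_one_sub (hv : IsPosMuckenhouptOne μ v) (hμ : IsDoubling μ) {p : ℝ} (hp : 1 < p) :
    MuckenhouptA μ p (fun x => (v x ^ (1 - p)).toReal) ∧
      ReverseHolderTop μ (fun x => (v x ^ (1 - p)).toReal) := by
  have hp1 : 0 < p - 1 := by linarith
  obtain ⟨C, hC⟩ := hv.exists_laverage_le
  have htop : ∀ x, v x ^ (1 - p) ≠ ∞ := fun x => by
    simp [ENNReal.rpow_eq_top_iff, hv.ne_zero x, hp.le]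
  have hof : ∀ x, ENNReal.ofReal (v x ^ (1 - p)).toReal = v x ^ (1 - p) := fun x =>
    ENNReal.ofReal_toReal (htop x)
  have hinv : ∀ y, (v y ^ (1 - p)) ^ (-(1 / (p - 1))) = v y := fun y => by
    rw [← ENNReal.rpow_mul, show (1 - p) * -(1 / (p - 1)) = 1 by field_simp; ring,
      ENNReal.rpow_one]
  have hm0 : ∀ x r, 0 < r → (⨍⁻ y in ball x r, v y ∂μ) ^ (p - 1) ≠ 0 := fun x r hr => by
    simp [ENNReal.rpow_eq_zero_iff, hv.laverage_ne_zero hμ x hr, hp.le]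
  have hmt : ∀ x r, 0 < r → (⨍⁻ y in ball x r, v y ∂μ) ^ (p - 1) ≠ ∞ := fun x r hr =>
    ENNReal.rpow_ne_top_of_nonneg hp1.le (hv.laverage_ne_top hμ x hr)
  have hpt : ∀ x r, 0 < r → ∀ y ∈ ball x r, v y ^ (1 - p) ≤
      ((C ^ (p - 1) : ℝ≥0) : ℝ≥0∞) / (⨍⁻ y in ball x r, v y ∂μ) ^ (p - 1) := by
    intro x r hr y hy
    rw [ENNReal.le_div_iff_mul_le (Or.inl (hm0 x r hr)) (Or.inl (hmt x r hr)),
      ENNReal.coe_rpow_of_nonneg _ hp1.le, show 1 - p = -(p - 1) by ring, ENNReal.rpow_neg]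
    calc (v y ^ (p - 1))⁻¹ * (⨍⁻ y in ball x r, v y ∂μ) ^ (p - 1)
        ≤ (v y ^ (p - 1))⁻¹ * (C * v y) ^ (p - 1) := by
          gcongr
          exact hC x r y hy
      _ = (C : ℝ≥0∞) ^ (p - 1) * ((v y ^ (p - 1))⁻¹ * v y ^ (p - 1)) := by
          rw [ENNReal.mul_rpow_of_nonneg _ _ hp1.le]
          ring
      _ ≤ (C : ℝ≥0∞) ^ (p - 1) * 1 := by
          gcongr
          exact ENNReal.inv_mul_le_one _
      _ = _ := mul_one _
  have havg : ∀ x r, 0 < r → ⨍⁻ y in ball x r, v y ^ (1 - p) ∂μ ≤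
      ((C ^ (p - 1) : ℝ≥0) : ℝ≥0∞) / (⨍⁻ y in ball x r, v y ∂μ) ^ (p - 1) := by
    intro x r hr
    rw [← setLAverage_const (hμ.measure_ball_pos x hr).ne' (hμ.measure_ball_lt_top x r).ne
      (((C ^ (p - 1) : ℝ≥0) : ℝ≥0∞) / (⨍⁻ y in ball x r, v y ∂μ) ^ (p - 1))]
    refine laverage_mono_ae ?_
    filter_upwards [ae_restrict_mem measurableSet_ball] with y hy using hpt x r hr y hy
  -- Hölder complements `hpt`: the bound `C ^ (p - 1) / ⟨v⟩ ^ (p - 1)` is at most `C ^ (p - 1)`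
  -- times the average of `v ^ (1 - p)`, which gives `RH_∞`.
  have hHolder : ∀ x r, 0 < r → 1 ≤ (⨍⁻ y in ball x r, v y ^ (1 - p) ∂μ) *
      (⨍⁻ y in ball x r, v y ∂μ) ^ (p - 1) := by
    intro x r hr
    have hb0 := (hμ.measure_ball_pos x hr).ne'
    have hbt := (hμ.measure_ball_lt_top x r).ne
    have hone : ((μ.restrict (ball x r)) univ)⁻¹ * (μ.restrict (ball x r)) univ = 1 := by
      rw [Measure.restrict_apply_univ, ENNReal.inv_mul_cancel hb0 hbt]
    have h := measure_univ_rpow_le_lintegral_mul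
      (ν := ((μ.restrict (ball x r)) univ)⁻¹ • μ.restrict (ball x r)) hp
      (W := fun y => v y ^ (1 - p)) (hv.measurable.pow_const _).aemeasurable
      (Measure.ae_smul_measure (by
        filter_upwards [ae_restrict_of_ae hv.ae_ne_top] with y hy
        simp [ENNReal.rpow_eq_zero_iff, hv.ne_zero y, hy]) _) (.of_forall htop)
    simp only [hinv] at h
    rw [Measure.smul_apply, smul_eq_mul, hone, ENNReal.one_rpow] at h
    exact h
  have hweight : IsWeight μ fun x => (v x ^ (1 - p)).toReal := by
    refine isWeight_toReal (hv.measurable.pow_const _) (.of_forall htop) fun x r hr => ?_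
    have hbt := (hμ.measure_ball_lt_top x r).ne
    rw [← measure_mul_setLAverage _ hbt]
    exact ENNReal.mul_lt_top hbt.lt_top ((havg x r hr).trans_lt
      (ENNReal.div_lt_top ENNReal.coe_ne_top (hm0 x r hr)))
  refine ⟨⟨hweight, lt_of_le_of_lt ?_ (ENNReal.coe_lt_top (r := C ^ (p - 1)))⟩, hweight,
    C ^ (p - 1), fun x r hr => ?_⟩
  · refine iSup_le fun x => iSup_le fun r => iSup_le fun hr => ?_
    simp only [hof, hinv]
    rw [← ENNReal.le_div_iff_mul_le (Or.inl (hm0 x r hr)) (Or.inl (hmt x r hr))]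
    exact havg x r hr
  · simp only [hof]
    refine essSup_le_of_ae_le _ ?_
    filter_upwards [ae_restrict_mem measurableSet_ball] with y hy
    refine (hpt x r hr y hy).trans ?_
    rw [div_eq_mul_inv]
    gcongr
    rw [← one_div, ENNReal.div_le_iff (hm0 x r hr) (hmt x r hr)]
    exact hHolder x r hr

end IsPosMuckenhouptOne

/-! ### Refined factorization -/

lemma MuckenhouptA.laverage_mul_le {μ : Measure X} {p : ℝ} {w : X → ℝ} (hw : MuckenhouptA μ p w)
    (x : X) {r : ℝ} (hr : 0 < r) :
    (⨍⁻ y in ball x r, ENNReal.ofReal (w y) ∂μ) *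
      (⨍⁻ y in ball x r, ENNReal.ofReal (w y) ^ (-(1 / (p - 1))) ∂μ) ^ (p - 1) ≤
      (muckenhouptConst μ p w).toNNReal := by
  rw [ENNReal.coe_toNNReal hw.2.ne]
  exact le_iSup_of_le x (le_iSup_of_le r (le_iSup_of_le hr le_rfl))

lemma IsWeight.aemeasurable [BorelSpace X] {μ : Measure X} (hμ : IsDoubling μ) {w : X → ℝ}
    (hw : IsWeight μ w) : AEMeasurable w μ :=
  have := hμ.secondCountableTopology
  hw.2.aestronglyMeasurable.aemeasurable

/-- An `A_p` weight vanishes almost everywhere or is positive almost everywhere. -/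
lemma MuckenhouptA.ae_eq_zero_or_ae_pos [BorelSpace X] {μ : Measure X} (hμ : IsDoubling μ)
    {p : ℝ} (hp : 1 < p) {w : X → ℝ} (hw : MuckenhouptA μ p w) :
    (∀ᵐ x ∂μ, w x = 0) ∨ ∀ᵐ x ∂μ, 0 < w x := by
  rcases isEmpty_or_nonempty X with h | ⟨⟨x₀⟩⟩
  · left
    rw [Measure.eq_zero_of_isEmpty μ]
    simp
  have hp1 : 0 < p - 1 := by linarith
  have hm := (hw.1.aemeasurable hμ).ennreal_ofReal
  have hae : ∀ {P : X → Prop} (N : ℕ), (∀ n : ℕ, N ≤ n → ∀ᵐ y ∂μ.restrict (ball x₀ n), P y) →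
      ∀ᵐ y ∂μ, P y := by
    intro P N h
    rw [← Measure.restrict_univ (μ := μ), ← iUnion_ball_nat x₀, ae_restrict_iUnion_iff]
    intro n
    exact ae_restrict_of_ae_restrict_of_subset
      (ball_subset_ball (by exact_mod_cast le_max_left n N)) (h (max n N) (le_max_right _ _))
  -- If `w` has positive mass on one ball, then on every larger concentric ball the `A_p` bound
  -- makes the dual average finite, which excludes zeros of `w` up to null sets.
  by_cases h : ∃ N : ℕ, ∫⁻ y in ball x₀ N, ENNReal.ofReal (w y) ∂μ ≠ 0
  · right
    obtain ⟨N, hN⟩ := h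
    refine hae N fun n hn => ?_
    have hn0 : ∫⁻ y in ball x₀ n, ENNReal.ofReal (w y) ∂μ ≠ 0 := by
      refine fun h0 => hN (le_antisymm (le_trans ?_ h0.le) zero_le)
      exact lintegral_mono_set (ball_subset_ball (by exact_mod_cast hn))
    have hr : (0 : ℝ) < n := by
      by_contra! hle
      simp [ball_eq_empty.2 hle] at hn0
    have hbt := (hμ.measure_ball_lt_top x₀ n).ne
    have hA := hw.laverage_mul_le x₀ hr
    have hfin : (⨍⁻ y in ball x₀ n, ENNReal.ofReal (w y) ^ (-(1 / (p - 1))) ∂μ) ≠ ∞ := by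
      intro htop
      rw [htop, ENNReal.top_rpow_of_pos hp1, ENNReal.mul_top, top_le_iff] at hA
      · exact ENNReal.coe_ne_top hA
      · rw [setLAverage_eq]
        exact (ENNReal.div_pos hn0 hbt).ne'
    have hfin' : ∫⁻ y in ball x₀ n, ENNReal.ofReal (w y) ^ (-(1 / (p - 1))) ∂μ ≠ ∞ := by
      rw [← measure_mul_setLAverage _ hbt]
      exact ENNReal.mul_ne_top hbt hfin
    filter_upwards [ae_lt_top' (hm.restrict.pow_const _) hfin'] with y hy
    by_contra! hle
    rw [ENNReal.ofReal_of_nonpos hle, ENNReal.zero_rpow_of_neg (by simpa using hp)] at hy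
    exact lt_irrefl _ hy
  · left
    push Not at h
    have h0 : ∀ᵐ y ∂μ, ENNReal.ofReal (w y) = 0 := hae 0 fun n _ => by
      exact (lintegral_eq_zero_iff' hm.restrict).1 (h n)
    filter_upwards [h0, hw.1.1] with y hy hy0
    exact le_antisymm (ENNReal.ofReal_eq_zero.1 hy) hy0

lemma isWeight_zero (μ : Measure X) : IsWeight μ fun _ => (0 : ℝ) :=
  ⟨.of_forall fun _ => le_rfl, locallyIntegrable_zero⟩

lemma muckenhouptA_zero (μ : Measure X) (p : ℝ) : MuckenhouptA μ p fun _ => 0 := by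
  refine ⟨isWeight_zero μ, ?_⟩
  simp [muckenhouptConst]

lemma muckenhouptAOne_zero (μ : Measure X) : MuckenhouptAOne μ fun _ => 0 :=
  ⟨isWeight_zero μ, 0, fun x r _ => by simp⟩

lemma reverseHolder_zero (μ : Measure X) {s : ℝ} (hs : 0 < s) : ReverseHolder μ s fun _ => 0 :=
  ⟨isWeight_zero μ, 0, fun x r _ => by
    simp [ENNReal.zero_rpow_of_pos hs, ENNReal.zero_rpow_of_pos (inv_pos.2 hs)]⟩

lemma reverseHolderTop_zero (μ : Measure X) : ReverseHolderTop μ fun _ => 0 :=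
  ⟨isWeight_zero μ, 0, fun x r _ => by
    simp only [ENNReal.ofReal_zero, ENNReal.coe_zero, zero_mul, nonpos_iff_eq_zero]
    exact essSup_const_bot⟩

/-- If `w ∈ A_p ∩ RH_s` is positive, then `w ^ s ∈ A_q` with `q = s (p - 1) + 1`. -/
lemma isPosMuckenhoupt_rpow {μ : Measure X} {p s : ℝ} (hp : 1 < p) (hs : 1 < s) {w : X → ℝ}
    (hA : MuckenhouptA μ p w) (hR : ReverseHolder μ s w) {V : X → ℝ≥0∞} (hV : Measurable V)
    (hV0 : ∀ x, V x ≠ 0) (hVt : ∀ x, V x ≠ ∞) (hVw : V =ᵐ[μ] fun x => ENNReal.ofReal (w x)) :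
    IsPosMuckenhoupt μ (s * (p - 1) + 1) fun x => V x ^ s := by
  have hp1 : 0 < p - 1 := by linarith
  have hs0 : 0 < s := by linarith
  obtain ⟨C, hC⟩ := hR.2
  refine ⟨hV.pow_const _, fun x => by simp [ENNReal.rpow_eq_zero_iff, hV0 x, hVt x],
    fun x => by simp [ENNReal.rpow_eq_top_iff, hV0 x, hVt x],
    (C * (muckenhouptConst μ p w).toNNReal) ^ s, fun x r hr => ?_⟩
  have hres : V =ᵐ[μ.restrict (ball x r)] fun x => ENNReal.ofReal (w x) := ae_restrict_of_ae hVw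
  have h1 : ⨍⁻ y in ball x r, V y ^ s ∂μ = ⨍⁻ y in ball x r, ENNReal.ofReal (w y) ^ s ∂μ :=
    laverage_congr (hres.mono fun y hy => by simp only [hy])
  have h2 : ⨍⁻ y in ball x r, (V y ^ s) ^ (-(1 / (s * (p - 1) + 1 - 1))) ∂μ =
      ⨍⁻ y in ball x r, ENNReal.ofReal (w y) ^ (-(1 / (p - 1))) ∂μ := by
    refine laverage_congr (hres.mono fun y hy => ?_)
    simp only
    rw [hy, ← ENNReal.rpow_mul]
    congr 1
    rw [add_sub_cancel_right]
    field_simp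
  have h3 := hC x r hr
  rw [one_div, ENNReal.rpow_inv_le_iff hs0] at h3
  -- With `q - 1 = s * (p - 1)` the `A_q` product of `w ^ s` is at most the `s`-th power of `C`
  -- times the `A_p` product of `w`.
  rw [h1, h2, add_sub_cancel_right, mul_comm s, ENNReal.rpow_mul]
  calc _ ≤ ((C : ℝ≥0∞) * ⨍⁻ y in ball x r, ENNReal.ofReal (w y) ∂μ) ^ s *
        ((⨍⁻ y in ball x r, ENNReal.ofReal (w y) ^ (-(1 / (p - 1))) ∂μ) ^ (p - 1)) ^ s :=
        mul_le_mul_left h3 _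
    _ = ((C : ℝ≥0∞) * ((⨍⁻ y in ball x r, ENNReal.ofReal (w y) ∂μ) *
        (⨍⁻ y in ball x r, ENNReal.ofReal (w y) ^ (-(1 / (p - 1))) ∂μ) ^ (p - 1))) ^ s := by
        rw [← ENNReal.mul_rpow_of_nonneg _ _ hs0.le, mul_assoc]
    _ ≤ _ := by
        rw [ENNReal.coe_rpow_of_nonneg _ hs0.le, ENNReal.coe_mul]
        exact ENNReal.rpow_le_rpow (mul_le_mul_right (hA.laverage_mul_le x hr) _) hs0.le

theorem exists_refined_factorization [BorelSpace X] {μ : Measure X} (hμ : IsDoubling μ)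
    {p s : ℝ} (hp : 1 < p) (hs : 1 < s) {w : X → ℝ} (hA : MuckenhouptA μ p w)
    (hR : ReverseHolder μ s w) :
    ∃ w₁ w₂ : X → ℝ, (MuckenhouptAOne μ w₁ ∧ ReverseHolder μ s w₁) ∧
      (MuckenhouptA μ p w₂ ∧ ReverseHolderTop μ w₂) ∧ w =ᵐ[μ] fun x => w₁ x * w₂ x := by
  have hp1 : 0 < p - 1 := by linarith
  have hs0 : 0 < s := by linarith
  rcases hA.ae_eq_zero_or_ae_pos hμ hp with h0 | h0
  · refine ⟨_, _, ⟨muckenhouptAOne_zero μ, reverseHolder_zero μ hs0⟩,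
      ⟨muckenhouptA_zero μ p, reverseHolderTop_zero μ⟩, ?_⟩
    filter_upwards [h0] with x hx
    simp [hx]
  · have hm := hA.1.aemeasurable hμ
    have hset : MeasurableSet {x | 0 < hm.mk w x} :=
      measurableSet_lt measurable_const hm.measurable_mk
    classical
    -- A version of `w` that is measurable and `(0, ∞)`-valued everywhere; the value `1` is used
    -- only on a null set.
    set V : X → ℝ≥0∞ := {x | 0 < hm.mk w x}.piecewise (fun x => ENNReal.ofReal (hm.mk w x)) 1
    have hVm : Measurable V := hm.measurable_mk.ennreal_ofReal.piecewise hset measurable_const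
    have hV0 : ∀ x, V x ≠ 0 := fun x => by
      by_cases h : 0 < hm.mk w x <;> simp [V, h]
    have hVt : ∀ x, V x ≠ ∞ := fun x => by
      by_cases h : 0 < hm.mk w x <;> simp [V, h]
    have hVw : V =ᵐ[μ] fun x => ENNReal.ofReal (w x) := by
      filter_upwards [h0, hm.ae_eq_mk] with x hx hx'
      rw [hx'] at hx
      simp [V, hx, hx']
    obtain ⟨v₁, v₂, h₁, h₂, h⟩ :=
      (isPosMuckenhoupt_rpow hp hs hA hR hVm hV0 hVt hVw).exists_factorization hμ
        (by nlinarith)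
    refine ⟨_, _, h₁.rpow_one_div hμ hs, h₂.rpow_one_sub hμ hp, ?_⟩
    filter_upwards [h, h0, hVw, h₁.ae_ne_top, h₂.ae_ne_top] with x hx hx0 hxw ht₁ ht₂
    have h4 : v₂ x ^ (1 - (s * (p - 1) + 1)) ≠ ∞ := by
      simp [ENNReal.rpow_eq_top_iff, h₂.ne_zero x, ht₂]
    have h5 : V x = v₁ x ^ (1 / s) * v₂ x ^ (1 - p) := by
      rw [← ENNReal.rpow_rpow_inv hs0.ne' (V x), hx, ENNReal.mul_rpow_of_ne_top ht₁ h4,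
        ← ENNReal.rpow_mul, one_div]
      congr 2
      field_simp
      ring
    rw [← ENNReal.toReal_mul, ← h5, hxw, ENNReal.toReal_ofReal hx0.le]

/-- A product of a weight in `A_1 ∩ RH_s` and one in `A_p ∩ RH_∞` is in `A_p ∩ RH_s`. -/
theorem muckenhouptA_and_reverseHolder_of_mul [BorelSpace X] {μ : Measure X} (hμ : IsDoubling μ)
    {p s : ℝ} (hp : 1 < p) (hs : 1 < s) {w w₁ w₂ : X → ℝ} (h₁ : MuckenhouptAOne μ w₁)
    (h₁' : ReverseHolder μ s w₁) (h₂ : MuckenhouptA μ p w₂) (h₂' : ReverseHolderTop μ w₂)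
    (hw : w =ᵐ[μ] fun x => w₁ x * w₂ x) : MuckenhouptA μ p w ∧ ReverseHolder μ s w := by
  have hp1 : 0 < p - 1 := by linarith
  have hs0 : 0 < s := by linarith
  have hm₁ := h₁.1.aemeasurable hμ
  have hm₂ := h₂.1.aemeasurable hμ
  obtain ⟨C₁, hC₁⟩ := h₁.2
  obtain ⟨C₂, hC₂⟩ := h₁'.2
  obtain ⟨C₃, hC₃⟩ := h₂'.2
  set a : X → ℝ≥0∞ := fun x => ENNReal.ofReal (w₁ x)
  set b : X → ℝ≥0∞ := fun x => ENNReal.ofReal (w₂ x)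
  have hat : ∀ x, a x ≠ ∞ := fun x => ENNReal.ofReal_ne_top
  have hbt : ∀ x, b x ≠ ∞ := fun x => ENNReal.ofReal_ne_top
  have hab : (fun x => ENNReal.ofReal (w x)) =ᵐ[μ] fun x => a x * b x := by
    filter_upwards [hw, h₁.1.1] with x hx h0
    rw [hx, ENNReal.ofReal_mul h0]
  have hres : ∀ x r, (fun x => ENNReal.ofReal (w x)) =ᵐ[μ.restrict (ball x r)]
      fun x => a x * b x := fun x r => ae_restrict_of_ae hab
  have hne : ∀ x r, 0 < r → (ae (μ.restrict (ball x r))).NeBot := fun x r hr => by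
    rw [ae_restrict_neBot]
    exact (hμ.measure_ball_pos x hr).ne'
  have hinf : ∀ x r, ∀ᵐ y ∂μ.restrict (ball x r), essInf a (μ.restrict (ball x r)) ≤ a y :=
    fun x r => ae_essInf_le
  have hsup : ∀ x r, ∀ᵐ y ∂μ.restrict (ball x r),
      b y ≤ C₃ * ⨍⁻ y in ball x r, b y ∂μ := by
    intro x r
    rcases le_or_gt r 0 with hr | hr
    · simp [ball_eq_empty.2 hr]
    · exact (ENNReal.ae_le_essSup b).mono fun y hy => hy.trans (hC₃ x r hr)
  have hinft : ∀ x r, 0 < r → essInf a (μ.restrict (ball x r)) ≠ ∞ := by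
    intro x r hr
    have := hne x r hr
    obtain ⟨y, hy⟩ := (hinf x r).exists
    exact ne_top_of_le_ne_top (hat y) hy
  -- As `b` is finite, its dual average is nonzero, so an infinite average would violate the `A_p`
  -- bound.
  have hbavg : ∀ x r, 0 < r → ⨍⁻ y in ball x r, b y ∂μ ≠ ∞ := by
    intro x r hr htop
    have := hne x r hr
    have hA := h₂.laverage_mul_le x hr
    have h0 : (⨍⁻ y in ball x r, b y ^ (-(1 / (p - 1))) ∂μ) ≠ 0 := by
      rw [setLAverage_eq]
      refine (ENNReal.div_pos ?_ (hμ.measure_ball_lt_top x r).ne).ne'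
      intro h
      obtain ⟨y, hy⟩ := ((lintegral_eq_zero_iff'
        (hm₂.ennreal_ofReal.restrict.pow_const _)).1 h).exists
      have hpn : -(1 / (p - 1)) < 0 := by simpa using hp
      rw [Pi.zero_apply, ENNReal.rpow_eq_zero_iff] at hy
      rcases hy with hy | hy
      · exact lt_asymm hy.2 hpn
      · exact hbt y hy.1
    rw [htop, ENNReal.top_mul, top_le_iff] at hA
    · exact ENNReal.coe_ne_top hA
    · rw [ne_eq, ENNReal.rpow_eq_zero_iff, not_or]
      exact ⟨fun h => h0 h.1, fun h => lt_asymm h.2 hp1⟩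
  -- `RH_∞` pulls `b` out of the average and `A_1` replaces the average of `a` by its essential
  -- infimum; `hlower` is the matching lower bound.
  have hupper : ∀ x r, 0 < r → ⨍⁻ y in ball x r, a y * b y ∂μ ≤
      (C₃ * ⨍⁻ y in ball x r, b y ∂μ) * (C₁ * essInf a (μ.restrict (ball x r))) := by
    intro x r hr
    calc ⨍⁻ y in ball x r, a y * b y ∂μ
        ≤ ⨍⁻ y in ball x r, (C₃ * ⨍⁻ y in ball x r, b y ∂μ) * a y ∂μ := by
          refine laverage_mono_ae ?_
          filter_upwards [hsup x r] with y hy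
          rw [mul_comm]
          gcongr
      _ = (C₃ * ⨍⁻ y in ball x r, b y ∂μ) * ⨍⁻ y in ball x r, a y ∂μ :=
          laverage_const_mul _ (ENNReal.mul_ne_top ENNReal.coe_ne_top (hbavg x r hr))
      _ ≤ _ := by
          gcongr
          exact hC₁ x r hr
  have hlower : ∀ x r, 0 < r → essInf a (μ.restrict (ball x r)) * ⨍⁻ y in ball x r, b y ∂μ ≤
      ⨍⁻ y in ball x r, a y * b y ∂μ := by
    intro x r hr
    rw [← laverage_const_mul _ (hinft x r hr)]
    refine laverage_mono_ae ?_
    filter_upwards [hinf x r] with y hy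
    gcongr
  have hweight : IsWeight μ w := by
    refine isWeight_of_lintegral_lt_top
      ((hm₁.mul hm₂).congr hw.symm).aestronglyMeasurable ?_ fun x r hr => ?_
    · filter_upwards [hw, h₁.1.1, h₂.1.1] with x hx h h'
      rw [hx]
      exact mul_nonneg h h'
    · have hmt := (hμ.measure_ball_lt_top x r).ne
      rw [lintegral_congr_ae (hres x r), ← measure_mul_setLAverage _ hmt]
      refine ENNReal.mul_lt_top hmt.lt_top ((hupper x r hr).trans_lt ?_)
      exact ENNReal.mul_lt_top (ENNReal.mul_lt_top ENNReal.coe_lt_top (hbavg x r hr).lt_top)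
        (ENNReal.mul_lt_top ENNReal.coe_lt_top (hinft x r hr).lt_top)
  refine ⟨⟨hweight, lt_of_le_of_lt ?_ (ENNReal.coe_lt_top
    (r := C₃ * C₁ * (muckenhouptConst μ p w₂).toNNReal))⟩, hweight, C₃ * C₂ * C₁, fun x r hr => ?_⟩
  · refine iSup_le fun x => iSup_le fun r => iSup_le fun hr => ?_
    have hpow : (fun y => ENNReal.ofReal (w y) ^ (-(1 / (p - 1)))) =ᵐ[μ.restrict (ball x r)]
        fun y => a y ^ (-(1 / (p - 1))) * b y ^ (-(1 / (p - 1))) := by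
      filter_upwards [hres x r] with y hy
      rw [hy, ENNReal.mul_rpow_of_ne_top (hat y) (hbt y)]
    rw [laverage_congr (hres x r), laverage_congr hpow]
    have hup := hupper x r hr
    set α := essInf a (μ.restrict (ball x r)) with hα
    -- If `α = 0` then `hup` makes the average of the product vanish, and the convention `0 * ∞ = 0`
    -- settles the `A_p` product. Otherwise the power of `α` in `hdual` is finite and cancels the
    -- `α` in `hup`.
    rcases eq_or_ne α 0 with hα0 | hα0
    · rw [hα0, mul_zero, mul_zero, nonpos_iff_eq_zero] at hup
      rw [hup, zero_mul]
      exact zero_le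
    · have hαt : α ≠ ∞ := hinft x r hr
      have hdual : ⨍⁻ y in ball x r, a y ^ (-(1 / (p - 1))) * b y ^ (-(1 / (p - 1))) ∂μ ≤
          α ^ (-(1 / (p - 1))) * ⨍⁻ y in ball x r, b y ^ (-(1 / (p - 1))) ∂μ := by
        rw [← laverage_const_mul _ (by simp [ENNReal.rpow_eq_top_iff, hα0, hαt])]
        refine laverage_mono_ae ?_
        filter_upwards [hinf x r] with y hy
        gcongr ?_ * _
        rw [ENNReal.rpow_neg, ENNReal.rpow_neg]
        gcongr
      calc _ ≤ ((C₃ * ⨍⁻ y in ball x r, b y ∂μ) * (C₁ * α)) *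
            (α ^ (-(1 / (p - 1))) * ⨍⁻ y in ball x r, b y ^ (-(1 / (p - 1))) ∂μ) ^ (p - 1) :=
            mul_le_mul' hup (ENNReal.rpow_le_rpow hdual hp1.le)
        _ = C₃ * C₁ * (α * α⁻¹) * ((⨍⁻ y in ball x r, b y ∂μ) *
            (⨍⁻ y in ball x r, b y ^ (-(1 / (p - 1))) ∂μ) ^ (p - 1)) := by
            rw [ENNReal.mul_rpow_of_nonneg _ _ hp1.le, ← ENNReal.rpow_mul,
              show -(1 / (p - 1)) * (p - 1) = -1 by field_simp, ENNReal.rpow_neg_one]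
            ring
        _ ≤ _ := by
            rw [ENNReal.mul_inv_cancel hα0 hαt, mul_one, ENNReal.coe_mul, ENNReal.coe_mul]
            exact mul_le_mul_right (h₂.laverage_mul_le x hr) _
  · have hpow : (fun y => ENNReal.ofReal (w y) ^ s) =ᵐ[μ.restrict (ball x r)]
        fun y => (a y * b y) ^ s := (hres x r).mono fun y hy => by simp only [hy]
    rw [laverage_congr (hres x r), laverage_congr hpow]
    set β := C₃ * ⨍⁻ y in ball x r, b y ∂μ with hβ
    have hβt : β ≠ ∞ := ENNReal.mul_ne_top ENNReal.coe_ne_top (hbavg x r hr)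
    calc (⨍⁻ y in ball x r, (a y * b y) ^ s ∂μ) ^ (1 / s)
        ≤ (β ^ s * ⨍⁻ y in ball x r, a y ^ s ∂μ) ^ (1 / s) := by
          refine ENNReal.rpow_le_rpow ?_ (by positivity)
          rw [← laverage_const_mul _ (by finiteness)]
          refine laverage_mono_ae ?_
          filter_upwards [hsup x r] with y hy
          rw [← ENNReal.mul_rpow_of_nonneg _ _ hs0.le, mul_comm]
          gcongr
      _ = β * (⨍⁻ y in ball x r, a y ^ s ∂μ) ^ (1 / s) := by
          rw [ENNReal.mul_rpow_of_nonneg _ _ (by positivity), ← ENNReal.rpow_mul,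
            mul_one_div_cancel hs0.ne', ENNReal.rpow_one]
      _ ≤ β * (C₂ * (C₁ * essInf a (μ.restrict (ball x r)))) := by
          refine mul_le_mul_right ((hC₂ x r hr).trans ?_) _
          exact mul_le_mul_right (hC₁ x r hr) _
      _ = C₃ * C₂ * C₁ * (essInf a (μ.restrict (ball x r)) * ⨍⁻ y in ball x r, b y ∂μ) := by
          rw [hβ]
          ring
      _ ≤ _ := by
          rw [ENNReal.coe_mul, ENNReal.coe_mul]
          exact mul_le_mul_right (hlower x r hr) _

end JonesFactorization

theorem mainTheorem3 {X : Type*} [MetricSpace X] [CompleteSpace X] [MeasurableSpace X]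
    [BorelSpace X] (μ : Measure X) (hμ : JonesFactorization.IsDoubling μ)
    (hA : JonesFactorization.HasAnnularDecay μ) (p s : ℝ) (hp : 1 < p) (hs : 1 < s)
    (w : X → ℝ) :
    (JonesFactorization.MuckenhouptA μ p w ∧ JonesFactorization.ReverseHolder μ s w) ↔
      ∃ w₁ w₂ : X → ℝ,
        (JonesFactorization.MuckenhouptAOne μ w₁ ∧ JonesFactorization.ReverseHolder μ s w₁) ∧
        (JonesFactorization.MuckenhouptA μ p w₂ ∧ JonesFactorization.ReverseHolderTop μ w₂) ∧
        w =ᵐ[μ] fun x => w₁ x * w₂ x := by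
  constructor
  · rintro ⟨h, h'⟩
    exact JonesFactorization.exists_refined_factorization hμ hp hs h h'
  · rintro ⟨w₁, w₂, ⟨h₁, h₁'⟩, ⟨h₂, h₂'⟩, hw⟩
    exact JonesFactorization.muckenhouptA_and_reverseHolder_of_mul hμ hp hs h₁ h₁' h₂ h₂' hw
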